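/- Let $G,H$ be discrete groups. A *$*$-algebraic bundle* over $G$ is a family $(A_t)_{t\in G}$ of complex vector spaces with an associative product, bilinear on $A_t\times A_s\to A_{ts}$, and an involution, conjugate linear from $A_t$ to $A_{t^{-1}}$, with $(ab)^*=b^*a^*$ and $a^{**}=a$. A *$C^*$-norm* on it is a norm on every $A_t$ such that $\|ab\|\le\|a\|\|b\|$, $\|a^*a\|=\|a\|^2$, and $a^*a\ge 0$ in the completion of $A_e$. A *Fell bundle* is a $*$-algebraic bundle with a $C^*$-norm in which every $A_t$ is complete; then $A_e$ is a $C^*$-algebra. For a Fell bundle $\mathcal A=(A_t)_{t\in G}$ let $\ell^2(\mathcal A)$ be the right Hilbert $A_e$-module of sections $\xi$, $\xi(t)\in A_t$, for which $\sum_t\xi(t)^*\xi(t)$ converges in norm in $A_e$, with $\langle\xi,\eta\rangle=\sum_t\xi(t)^*\eta(t)$. For $a\in A_t$ let $\Lambda(a)$ be the adjointable operator $(\Lambda(a)\xi)(s)=a\,\xi(t^{-1}s)$, and let $C^*_r(\mathcal A)$ be the $C^*$-subalgebra of the $C^*$-algebra $\mathcal L(\ell^2(\mathcal A))$ of adjointable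 operators generated by all $\Lambda(a)$, $a\in A_t$, $t\in G$. Let $\mathcal A=(A_t)_{t\in G}$ and $\mathcal B=(B_s)_{s\in H}$ be Fell bundles and let $\alpha$ be a $C^*$-norm on the $*$-algebraic bundle $\mathcal A\odot\mathcal B=(A_t\odot B_s)_{(t,s)\in G\times H}$ (algebraic tensor products over $\mathbb C$, with $(a\odot b)(a'\odot b')=aa'\odot bb'$ and $(a\odot b)^*=a^*\odot b^*$). Let $\mathcal A\otimes_\alpha\mathcal B$ be the Fell bundle over $G\times H$ obtained by completing the fibers; its unit fiber is the completion $A_e\otimes_\alpha B_e$. Let $\ell^2(\mathcal A)\otimes_\alpha\ell^2(\mathcal B)$ be the Hilbert $A_e\otimes_\alpha B_e$-module obtained by completing $\ell^2(\mathcal A)\odot\ell^2(\mathcal B)$, with $\langle\xi\odot\eta,\xi'\odot\eta'\rangle=\langle\xi,\xi'\rangle\otimes\langle\eta,\eta'\rangle$, in the norm $x\mapsto\alpha(\langle x,x\rangle)^{1/2}$. For $S\in\mathcal L(\ell^2(\mathcal A))$ and $T\in\mathcal L(\ell^2(\mathcal B))$ let $S\otimes T$ be the adjointable operator on it with $(S\otimes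 T)(\xi\otimes\eta)=S\xi\otimes T\eta$. For $z=\sum_i S_i\odot T_i$ in $\mathcal L(\ell^2(\mathcal A))\odot\mathcal L(\ell^2(\mathcal B))$ put $\hat\alpha(z)=\|\sum_i S_i\otimes T_i\|$. Let $\mathcal L(\ell^2(\mathcal A))\otimes_{\hat\alpha}\mathcal L(\ell^2(\mathcal B))$ be the closure of the linear span of all $S\otimes T$ in $\mathcal L(\ell^2(\mathcal A)\otimes_\alpha\ell^2(\mathcal B))$, and $C^*_r(\mathcal A)\otimes_{\hat\alpha}C^*_r(\mathcal B)$ the closure in it of the linear span of all $S\otimes T$ with $S\in C^*_r(\mathcal A)$, $T\in C^*_r(\mathcal B)$. Then $\hat\alpha(z)=0$ only for $z=0$, so that $\hat\alpha$ is a norm. Moreover there is an isometric linear bijection $$U:\ell^2(\mathcal A)\otimes_\alpha\ell^2(\mathcal B)\to\ell^2(\mathcal A\otimes_\alpha\mathcal B),\qquad U(\xi\otimes\eta)(t,s)=\xi(t)\otimes\eta(s),$$ that preserves the inner products and the right actions of $A_e\otimes_\alpha B_e$, and there is an isometric $*$-isomorphism $$\Psi:\ C^*_r(\mathcal A)\otimes_{\hat\alpha}C^*_r(\mathcal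 B)\ \xrightarrow{\ \cong\ }\ C^*_r(\mathcal A\otimes_\alpha\mathcal B)$$ such that $\Lambda(a)\otimes\Lambda(b)$ lies in the domain of $\Psi$ and $\Psi(\Lambda(a)\otimes\Lambda(b))=\Lambda(a\otimes b)$ for all $a\in A_t$, $b\in B_s$, $t\in G$, $s\in H$, and $\Psi(z)\,U=U\,z$ for every $z$. -/

import Mathlib

open scoped TensorProduct

universe u v u' v'

/-- A *-algebraic bundle over a discrete group `G`: complex vector spaces `fiber t`, a bilinear
associative product `fiber r × fiber s → fiber (r * s)` and a conjugate linear involution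
`fiber s → fiber s⁻¹`, with `(a b)⋆ = b⋆ a⋆` and `a⋆⋆ = a`. To avoid casts between fibers,
product and involution carry a proof that names the index of the target fiber. -/
structure StarBundle (G : Type u) [Group G] where
  fiber : G → Type v
  [addCommGroup : ∀ t, AddCommGroup (fiber t)]
  [module : ∀ t, Module ℂ (fiber t)]
  mul : ∀ {r s t : G}, r * s = t → fiber r →ₗ[ℂ] fiber s →ₗ[ℂ] fiber t
  star : ∀ {s t : G}, s⁻¹ = t → fiber s →ₗ⋆[ℂ] fiber t
  mul_assoc : ∀ {r s t rs st rst : G} (h₁ : r * s = rs) (h₂ : rs * t = rst) (h₃ : s * t = st)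
    (h₄ : r * st = rst) (a : fiber r) (b : fiber s) (c : fiber t),
    mul h₂ (mul h₁ a b) c = mul h₄ a (mul h₃ b c)
  star_mul : ∀ {r s t r' s' t' : G} (h : r * s = t) (hr : r⁻¹ = r') (hs : s⁻¹ = s')
    (ht : t⁻¹ = t') (h' : s' * r' = t') (a : fiber r) (b : fiber s),
    star ht (mul h a b) = mul h' (star hs b) (star hr a)
  star_star : ∀ {s t : G} (h : s⁻¹ = t) (h' : t⁻¹ = s) (a : fiber s), star h' (star h a) = a

attribute [instance] StarBundle.addCommGroup StarBundle.module

/-- `a⋆ b`, an element of the unit fiber, for `a`, `b` in the same fiber. -/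
def StarBundle.inner {G : Type u} [Group G] (A : StarBundle.{u, v} G) (t : G) :
    A.fiber t →ₗ⋆[ℂ] A.fiber t →ₗ[ℂ] A.fiber 1 :=
  (A.mul (inv_mul_cancel t)).comp (A.star rfl)

/-- A C⋆-norm on a *-algebraic bundle: a norm on every fiber, submultiplicative, with the
C⋆-identity `‖a⋆ a‖ = ‖a‖²`, and such that `a⋆ a` is positive in the completion of the unit fiber,
that is, a limit of elements `c⋆ c` with `c` in the unit fiber. -/
structure CStarNorm {G : Type u} [Group G] (A : StarBundle.{u, v} G) where
  norm : ∀ {t : G}, A.fiber t → ℝ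
  norm_add_le : ∀ {t : G} (a b : A.fiber t), norm (a + b) ≤ norm a + norm b
  norm_smul : ∀ {t : G} (z : ℂ) (a : A.fiber t), norm (z • a) = ‖z‖ * norm a
  eq_zero : ∀ {t : G} (a : A.fiber t), norm a = 0 → a = 0
  norm_mul_le : ∀ {r s t : G} (h : r * s = t) (a : A.fiber r) (b : A.fiber s),
    norm (A.mul h a b) ≤ norm a * norm b
  norm_inner_self : ∀ {t : G} (a : A.fiber t), norm (A.inner t a a) = norm a ^ 2
  inner_self_nonneg : ∀ {t : G} (a : A.fiber t) (ε : ℝ), 0 < ε →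
    ∃ c : A.fiber 1, norm (A.inner t a a - A.inner 1 c c) < ε

/-- A pre-Fell bundle: a *-algebraic bundle with a C⋆-norm. -/
structure PreFellBundle (G : Type u) [Group G] extends StarBundle.{u, v} G where
  cnorm : CStarNorm toStarBundle

namespace PreFellBundle

variable {G : Type u} [Group G] (A : PreFellBundle.{u, v} G)

noncomputable instance instNormedAddCommGroup (t : G) : NormedAddCommGroup (A.fiber t) :=
  AddGroupNorm.toNormedAddCommGroup
    { toFun := A.cnorm.norm
      map_zero' := by simpa using A.cnorm.norm_smul (0 : ℂ) (0 : A.fiber t)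
      add_le' := A.cnorm.norm_add_le
      neg' := fun a => by simpa using A.cnorm.norm_smul (-1 : ℂ) a
      eq_zero_of_map_eq_zero' := A.cnorm.eq_zero }

theorem norm_def {t : G} (a : A.fiber t) : ‖a‖ = A.cnorm.norm a := rfl

noncomputable instance instNormedSpace (t : G) : NormedSpace ℂ (A.fiber t) where
  norm_smul_le z a := (A.cnorm.norm_smul z a).le

theorem norm_mul_le {r s t : G} (h : r * s = t) (a : A.fiber r) (b : A.fiber s) :
    ‖A.mul h a b‖ ≤ ‖a‖ * ‖b‖ := A.cnorm.norm_mul_le h a b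

theorem norm_inner_self {t : G} (a : A.fiber t) : ‖A.inner t a a‖ = ‖a‖ ^ 2 :=
  A.cnorm.norm_inner_self a

theorem norm_star {s t : G} (h : s⁻¹ = t) (a : A.fiber s) : ‖A.star h a‖ = ‖a‖ := by
  have key : ∀ {s t : G} (h : s⁻¹ = t) (a : A.fiber s), ‖a‖ ≤ ‖A.star h a‖ := by
    rintro s _ rfl a
    rcases (norm_nonneg a).eq_or_lt with h0 | h0
    · rw [← h0]; exact norm_nonneg _
    · have h1 : ‖a‖ ^ 2 ≤ ‖A.star rfl a‖ * ‖a‖ := by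
        rw [← A.norm_inner_self a]; exact A.norm_mul_le _ _ _
      nlinarith
  refine le_antisymm ?_ (key h a)
  have h' : t⁻¹ = s := by rw [← h, inv_inv]
  simpa [A.star_star h h'] using key h' (A.star h a)

/-- Every fiber is a Banach space. -/
def FibersComplete : Prop := ∀ t, CompleteSpace (A.fiber t)

end PreFellBundle

/-- A Fell bundle over a discrete group: a pre-Fell bundle with complete fibers. -/
structure FellBundle (G : Type u) [Group G] extends PreFellBundle.{u, v} G where
  complete : toPreFellBundle.FibersComplete

namespace FellBundle

variable {G : Type u} [Group G] (A : FellBundle.{u, v} G)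

instance (t : G) : CompleteSpace (A.fiber t) := A.complete t

/-- The unit fiber is a C⋆-algebra. -/
noncomputable instance instNonUnitalNormedRing : NonUnitalNormedRing (A.fiber 1) where
  __ := A.instNormedAddCommGroup 1
  mul a b := A.mul (mul_one 1) a b
  left_distrib a b c := (A.mul (mul_one 1) a).map_add b c
  right_distrib a b c := by
    change A.mul _ (a + b) c = A.mul _ a c + A.mul _ b c
    simp
  zero_mul a := by change A.mul _ 0 a = 0; simp
  mul_zero a := by change A.mul _ a 0 = 0; simp
  mul_assoc a b c := A.mul_assoc _ _ _ _ a b c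
  norm_mul_le a b := A.norm_mul_le _ a b

noncomputable instance instNonUnitalCStarAlgebra : NonUnitalCStarAlgebra (A.fiber 1) where
  __ := A.instNonUnitalNormedRing
  __ := A.instNormedSpace 1
  star a := A.star inv_one a
  star_involutive a := A.star_star _ _ a
  star_mul a b := A.star_mul _ _ _ _ _ a b
  star_add a b := (A.star inv_one).map_add a b
  complete := (A.complete 1).complete
  norm_mul_self_le a := by
    have h : ∀ (t : G) (h : (1 : G)⁻¹ = t) (h' : t * 1 = 1),
        A.mul (mul_one 1) (A.star inv_one a) a = A.mul h' (A.star h a) a := by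
      intro t h h'
      obtain rfl : 1 = t := by rw [← h, inv_one]
      rfl
    have := A.norm_inner_self a
    rw [sq] at this
    rw [← this]
    exact (congrArg norm (h _ rfl (inv_mul_cancel 1))).ge
  smul_assoc z a b := by
    change A.mul _ (z • a) b = z • A.mul _ a b
    simp
  smul_comm z a b := ((A.mul (mul_one 1) a).map_smul z b).symm
  star_smul z a := (A.star inv_one).map_smulₛₗ z a

theorem mul_def (a b : A.fiber 1) : a * b = A.mul (mul_one 1) a b := rfl

theorem star_def (a : A.fiber 1) : star a = A.star inv_one a := rfl

noncomputable instance : PartialOrder (A.fiber 1) := CStarAlgebra.spectralOrder _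

instance : StarOrderedRing (A.fiber 1) := CStarAlgebra.spectralOrderedRing _

theorem inner_def {t : G} (a b : A.fiber t) :
    A.inner t a b = A.mul (inv_mul_cancel t) (A.star rfl a) b := rfl

theorem inner_one (a b : A.fiber 1) : A.inner 1 a b = star a * b := by
  have h : ∀ (t : G) (h : (1 : G)⁻¹ = t) (h' : t * 1 = 1),
      A.mul (mul_one 1) (A.star inv_one a) b = A.mul h' (A.star h a) b := by
    intro t h h'
    obtain rfl : 1 = t := by rw [← h, inv_one]
    rfl
  exact (h _ rfl (inv_mul_cancel 1)).symm

theorem star_inner {t : G} (a b : A.fiber t) : star (A.inner t a b) = A.inner t b a := by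
  rw [inner_def, star_def, A.star_mul _ (inv_inv t) rfl inv_one (inv_mul_cancel t),
    A.star_star _ _ a]
  rfl

theorem inner_mul {t : G} (a b : A.fiber t) (c : A.fiber 1) :
    A.inner t a (A.mul (mul_one t) b c) = A.inner t a b * c := by
  rw [inner_def, mul_def, inner_def, A.mul_assoc]

theorem inner_nonneg {t : G} (a : A.fiber t) : 0 ≤ A.inner t a a := by
  have hc : IsClosed {b : A.fiber 1 | 0 ≤ b} := CStarAlgebra.isClosed_nonneg
  have : A.inner t a a ∈ closure {b : A.fiber 1 | 0 ≤ b} := by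
    refine Metric.mem_closure_iff.2 fun ε hε => ?_
    obtain ⟨c, h⟩ := A.cnorm.inner_self_nonneg a ε hε
    refine ⟨A.inner 1 c c, ?_, ?_⟩
    · rw [inner_one]; exact star_mul_self_nonneg c
    · rw [dist_eq_norm]; exact h
  rwa [hc.closure_eq] at this

end FellBundle

section Extension

variable {V W V' W' Z : Type*} [SeminormedAddCommGroup V] [NormedSpace ℂ V]
  [SeminormedAddCommGroup W] [NormedSpace ℂ W] [NormedAddCommGroup Z] [NormedSpace ℂ Z]
  [NormedAddCommGroup V'] [NormedSpace ℂ V'] [NormedAddCommGroup W'] [NormedSpace ℂ W']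
  [CompleteSpace Z] {σ : ℂ →+* ℂ} [RingHomIsometric σ]

/-- The continuous extension of a bounded bilinear (or sesquilinear) map along dense isometric
inclusions `i`, `j`. -/
noncomputable def extendBilin (i : V →ₗᵢ[ℂ] V') (j : W →ₗᵢ[ℂ] W')
    (f : V →ₛₗ[σ] W →ₗ[ℂ] Z) (C : ℝ) (hf : ∀ v w, ‖f v w‖ ≤ C * ‖v‖ * ‖w‖) :
    V' →SL[σ] W' →L[ℂ] Z :=
  (((f.mkContinuous₂ C hf).extend i.toContinuousLinearMap).flip.extend
    j.toContinuousLinearMap).flip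

theorem extendBilin_apply {i : V →ₗᵢ[ℂ] V'} {j : W →ₗᵢ[ℂ] W'} (hi : DenseRange i)
    (hj : DenseRange j) (f : V →ₛₗ[σ] W →ₗ[ℂ] Z) (C : ℝ)
    (hf : ∀ v w, ‖f v w‖ ≤ C * ‖v‖ * ‖w‖) (v : V) (w : W) :
    extendBilin i j f C hf (i v) (j w) = f v w := by
  have h1 := ContinuousLinearMap.extend_eq
    ((f.mkContinuous₂ C hf).extend i.toContinuousLinearMap).flip
    (e := j.toContinuousLinearMap) hj j.isometry.isUniformInducing w
  have h2 := ContinuousLinearMap.extend_eq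
    (f.mkContinuous₂ C hf) (e := i.toContinuousLinearMap) hi i.isometry.isUniformInducing v
  simp only [LinearIsometry.coe_toContinuousLinearMap] at h1 h2
  simp [extendBilin, h1, h2]

end Extension

namespace PreFellBundle

open UniformSpace

variable {G : Type u} [Group G] (A : PreFellBundle.{u, v} G)

/-- The product of the completed bundle. -/
noncomputable def complMul {r s t : G} (h : r * s = t) :
    Completion (A.fiber r) →L[ℂ] Completion (A.fiber s) →L[ℂ] Completion (A.fiber t) :=
  extendBilin Completion.toComplₗᵢ Completion.toComplₗᵢ
    ((A.mul h).compr₂ (Completion.toComplₗᵢ (𝕜 := ℂ) (E := A.fiber t)).toLinearMap) 1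
    fun a b => by simpa using A.norm_mul_le h a b

theorem complMul_coe {r s t : G} (h : r * s = t) (a : A.fiber r) (b : A.fiber s) :
    A.complMul h (a : Completion (A.fiber r)) (b : Completion (A.fiber s)) = (A.mul h a b : A.fiber t) := by
  have hd : ∀ t, DenseRange (Completion.toComplₗᵢ (𝕜 := ℂ) (E := A.fiber t)) := fun t =>
    Completion.denseRange_coe
  have := extendBilin_apply (hd r) (hd s)
    ((A.mul h).compr₂ (Completion.toComplₗᵢ (𝕜 := ℂ) (E := A.fiber t)).toLinearMap) 1
    (fun a b => by simpa using A.norm_mul_le h a b) a b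
  simpa [complMul] using this

/-- The involution of the completed bundle. -/
noncomputable def complStar {s t : G} (h : s⁻¹ = t) :
    Completion (A.fiber s) →L⋆[ℂ] Completion (A.fiber t) :=
  ((Completion.toComplL (𝕜 := ℂ) (E := A.fiber t)).comp
    ((A.star h).mkContinuous 1 fun a => by simpa using (A.norm_star h a).le)).extend
    Completion.toComplL

theorem complStar_coe {s t : G} (h : s⁻¹ = t) (a : A.fiber s) :
    A.complStar h (a : Completion (A.fiber s)) = (A.star h a : A.fiber t) := by
  have := ContinuousLinearMap.extend_eq ((Completion.toComplL (𝕜 := ℂ) (E := A.fiber t)).comp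
    ((A.star h).mkContinuous 1 fun a => by simpa using (A.norm_star h a).le))
    (e := Completion.toComplL) Completion.denseRange_coe
    (Completion.isUniformInducing_coe (A.fiber s)) a
  simpa [complStar] using this

/-- The *-algebraic bundle whose fibers are the completions of the fibers of `A`, with the
continuous extensions of the product and the involution. -/
noncomputable def complStarBundle : StarBundle.{u, v} G where
  fiber t := Completion (A.fiber t)
  mul h := LinearMap.mk₂ ℂ (fun a b => A.complMul h a b) (by simp) (by simp) (by simp) (by simp)
  star h := (A.complStar h).toLinearMap
  mul_assoc h₁ h₂ h₃ h₄ a b c := by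
    simp only [LinearMap.mk₂_apply]
    refine Completion.induction_on₃ a b c (isClosed_eq (by fun_prop) (by fun_prop)) ?_
    intro a b c
    simp only [complMul_coe, A.mul_assoc h₁ h₂ h₃ h₄]
  star_mul h hr hs ht h' a b := by
    simp only [LinearMap.mk₂_apply, ContinuousLinearMap.coe_coe]
    refine Completion.induction_on₂ a b (isClosed_eq (by fun_prop) (by fun_prop)) ?_
    intro a b
    simp only [complMul_coe, complStar_coe, A.star_mul h hr hs ht h']
  star_star h h' a := by
    simp only [ContinuousLinearMap.coe_coe]
    refine Completion.induction_on a (isClosed_eq (by fun_prop) (by fun_prop)) ?_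
    intro a
    simp only [complStar_coe, A.star_star h h']

theorem complStarBundle_inner {t : G} (a b : Completion (A.fiber t)) :
    A.complStarBundle.inner t a b = A.complMul (inv_mul_cancel t) (A.complStar rfl a) b := rfl

theorem complStarBundle_inner_coe {t : G} (a b : A.fiber t) :
    A.complStarBundle.inner t (a : Completion (A.fiber t)) (b : Completion (A.fiber t))
      = ((A.inner t a b : A.fiber 1) : Completion (A.fiber 1)) := by
  rw [complStarBundle_inner, complStar_coe, complMul_coe]; rfl

/-- The extended norm is a C⋆-norm. -/
noncomputable def complCStarNorm : CStarNorm A.complStarBundle where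
  norm {t} := (fun a : Completion (A.fiber t) => ‖a‖)
  norm_add_le {t} := (norm_add_le : ∀ a b : Completion (A.fiber t), _)
  norm_smul {t} := (norm_smul : ∀ (z : ℂ) (b : Completion (A.fiber t)), _)
  eq_zero {t} := fun a : Completion (A.fiber t) => norm_eq_zero.1
  norm_mul_le {r s t} h := fun (a : Completion (A.fiber r)) (b : Completion (A.fiber s)) => by
    change ‖A.complMul h a b‖ ≤ ‖a‖ * ‖b‖
    refine Completion.induction_on₂ a b (isClosed_le (by fun_prop) (by fun_prop)) ?_
    intro a b
    simpa [complMul_coe] using A.norm_mul_le h a b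
  norm_inner_self {t} := fun a : Completion (A.fiber t) => by
    change ‖A.complMul (inv_mul_cancel t) (A.complStar rfl a) a‖ = ‖a‖ ^ 2
    refine Completion.induction_on a (isClosed_eq (by fun_prop) (by fun_prop)) ?_
    intro a
    rw [complStar_coe, complMul_coe, Completion.norm_coe, Completion.norm_coe]
    exact A.norm_inner_self a
  inner_self_nonneg {t} := fun (a : Completion (A.fiber t)) ε hε => by
    have hcont : Continuous fun b : Completion (A.fiber t) =>
        A.complMul (inv_mul_cancel t) (A.complStar rfl b) b := by fun_prop
    obtain ⟨b, hb⟩ := (Completion.denseRange_coe (α := A.fiber t)).exists_mem_open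
      ((isOpen_lt (f := fun b => ‖A.complMul (inv_mul_cancel t) (A.complStar rfl a) a
        - A.complMul (inv_mul_cancel t) (A.complStar rfl b) b‖) (g := fun _ => ε / 2)
        (by fun_prop) (by fun_prop))) ⟨a, by simpa using half_pos hε⟩
    obtain ⟨c, hc⟩ := A.cnorm.inner_self_nonneg b (ε / 2) (half_pos hε)
    refine ⟨(c : Completion (A.fiber 1)), ?_⟩
    rw [complStarBundle_inner_coe, complStarBundle_inner]
    change ‖A.complMul (inv_mul_cancel t) (A.complStar rfl a) a
      - ((A.inner 1 c c : A.fiber 1) : Completion (A.fiber 1))‖ < ε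
    have hc' : ‖((A.inner t b b : A.fiber 1) : Completion (A.fiber 1))
      - ((A.inner 1 c c : A.fiber 1) : Completion (A.fiber 1))‖ < ε / 2 := by
      rw [← Completion.coe_sub, Completion.norm_coe]; exact hc
    have hb' : ‖A.complMul (inv_mul_cancel t) (A.complStar rfl a) a
        - ((A.inner t b b : A.fiber 1) : Completion (A.fiber 1))‖ < ε / 2 := by
      simpa [complStar_coe, complMul_coe] using! hb
    calc _ ≤ _ := norm_sub_le_norm_sub_add_norm_sub _ _ _
      _ < ε / 2 + ε / 2 := add_lt_add hb' hc'
      _ = ε := add_halves ε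

/-- The completion as a pre-Fell bundle. -/
noncomputable def complPre : PreFellBundle.{u, v} G := ⟨A.complStarBundle, A.complCStarNorm⟩

/-- The fibers of the completion are the completions of the fibers. -/
noncomputable def complEquiv (t : G) : Completion (A.fiber t) ≃ₗᵢ[ℂ] A.complPre.fiber t where
  __ := LinearEquiv.refl ℂ (Completion (A.fiber t))
  norm_map' _ := rfl

/-- The completion of a pre-Fell bundle: the Fell bundle of the completed fibers. -/
noncomputable def completion : FellBundle.{u, v} G where
  __ := A.complPre
  complete t := (completeSpace_congr (e := (A.complEquiv t).toLinearEquiv.toEquiv)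
    (A.complEquiv t).isometry.isUniformEmbedding).1 inferInstance

/-- The inclusion of a pre-Fell bundle in its completion. -/
noncomputable def toCompletion (t : G) : A.fiber t →ₗᵢ[ℂ] A.completion.fiber t :=
  (A.complEquiv t).toLinearIsometry.comp Completion.toComplₗᵢ

theorem denseRange_toCompletion (t : G) : DenseRange (A.toCompletion t) :=
  (A.complEquiv t).surjective.denseRange.comp Completion.denseRange_coe (A.complEquiv t).continuous

theorem toCompletion_mul {r s t : G} (h : r * s = t) (a : A.fiber r) (b : A.fiber s) :
    A.completion.mul h (A.toCompletion r a) (A.toCompletion s b) = A.toCompletion t (A.mul h a b) :=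
  A.complMul_coe h a b

theorem toCompletion_star {s t : G} (h : s⁻¹ = t) (a : A.fiber s) :
    A.completion.star h (A.toCompletion s a) = A.toCompletion t (A.star h a) :=
  A.complStar_coe h a

theorem toCompletion_inner {t : G} (a b : A.fiber t) :
    A.completion.inner t (A.toCompletion t a) (A.toCompletion t b)
      = A.toCompletion 1 (A.inner t a b) :=
  A.complStarBundle_inner_coe a b

end PreFellBundle

section Tensor

variable {G : Type u} [Group G] {H : Type u'} [Group H]

/-- The algebraic tensor product of *-algebraic bundles over `G` and `H`: the *-algebraic bundle
over `G × H` with fibers `A_t ⊙ B_s`, product `(a ⊙ b) (a' ⊙ b') = a a' ⊙ b b'` and involution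
`(a ⊙ b)⋆ = a⋆ ⊙ b⋆`. -/
noncomputable def StarBundle.algTensor (A : StarBundle.{u, v} G) (B : StarBundle.{u', v'} H) :
    StarBundle.{max u u', max v v'} (G × H) where
  fiber p := A.fiber p.1 ⊗[ℂ] B.fiber p.2
  mul h := TensorProduct.map₂ (A.mul (congrArg Prod.fst h)) (B.mul (congrArg Prod.snd h))
  star h := TensorProduct.map (A.star (congrArg Prod.fst h)) (B.star (congrArg Prod.snd h))
  mul_assoc {r s t rs st rst} h₁ h₂ h₃ h₄ a b c := by
    induction a using TensorProduct.induction_on with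
    | zero => simp only [map_zero, LinearMap.zero_apply]
    | add x y hx hy => simp only [map_add, LinearMap.add_apply, hx, hy]
    | tmul a a' =>
      induction b using TensorProduct.induction_on with
      | zero => simp only [map_zero, LinearMap.zero_apply]
      | add x y hx hy => simp only [map_add, LinearMap.add_apply, hx, hy]
      | tmul b b' =>
        induction c using TensorProduct.induction_on with
        | zero => simp only [map_zero, LinearMap.zero_apply]
        | add x y hx hy => simp only [map_add, hx, hy]
        | tmul c c' =>
          simp only [TensorProduct.map₂_apply_tmul, TensorProduct.map_tmul]
          rw [A.mul_assoc _ _ (congrArg Prod.fst h₃) (congrArg Prod.fst h₄),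
            B.mul_assoc _ _ (congrArg Prod.snd h₃) (congrArg Prod.snd h₄)]
  star_mul h hr hs ht h' a b := by
    induction a using TensorProduct.induction_on with
    | zero => simp only [map_zero, LinearMap.zero_apply]
    | add x y hx hy => simp only [map_add, LinearMap.add_apply, hx, hy]
    | tmul a a' =>
      induction b using TensorProduct.induction_on with
      | zero => simp only [map_zero, LinearMap.zero_apply]
      | add x y hx hy => simp only [map_add, LinearMap.add_apply, hx, hy]
      | tmul b b' =>
        simp only [TensorProduct.map₂_apply_tmul, TensorProduct.map_tmul]
        rw [A.star_mul _ (congrArg Prod.fst hr) (congrArg Prod.fst hs) _ (congrArg Prod.fst h'),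
          B.star_mul _ (congrArg Prod.snd hr) (congrArg Prod.snd hs) _ (congrArg Prod.snd h')]
  star_star h h' a := by
    induction a using TensorProduct.induction_on with
    | zero => simp only [map_zero, LinearMap.zero_apply]
    | add x y hx hy => simp only [map_add, LinearMap.add_apply, hx, hy]
    | tmul a a' => simp [A.star_star, B.star_star]

end Tensor

/-- A (right) Hilbert module over a C⋆-algebra `B`: a Banach space `E` with a `B`-valued positive
inner product `form`, conjugate linear in the first variable, a right action `act` of `B` on `E` with
`⟪x, y b⟫ = ⟪x, y⟫ b`, and norm `‖x‖ = ‖⟪x, x⟫‖ ^ (1/2)`. (Associativity of the action and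
definiteness of the inner product follow from the axioms.) -/
class HilbertModule (B E : Type*) [NonUnitalCStarAlgebra B] [PartialOrder B] [StarOrderedRing B]
    [NormedAddCommGroup E] [NormedSpace ℂ E] [CompleteSpace E] where
  form : E →ₗ⋆[ℂ] E →ₗ[ℂ] B
  act : E →ₗ[ℂ] B →ₗ[ℂ] E
  star_form : ∀ x y, star (form x y) = form y x
  form_nonneg : ∀ x, 0 ≤ form x x
  form_act : ∀ x y b, form x (act y b) = form x y * b
  norm_sq_form : ∀ x, ‖x‖ ^ 2 = ‖form x x‖

section PreInner

variable {B V : Type*} [NonUnitalCStarAlgebra B] [PartialOrder B] [StarOrderedRing B]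
  [AddCommGroup V] [Module ℂ V] (p : V →ₗ⋆[ℂ] V →ₗ[ℂ] B)

theorem preInner_cauchySchwarz (hs : ∀ x y, star (p x y) = p y x) (hp : ∀ x, 0 ≤ p x x)
    (ha : ∀ x y, ∃ z, ∀ w, p w z = p w x * p x y) (x y : V) :
    ‖p x y‖ ^ 2 ≤ ‖p x x‖ * ‖p y y‖ := by
  obtain ⟨z, hz⟩ := ha x y
  set c := p x y with hc
  set n := ‖p x x‖ with hn
  have key : ∀ t : ℝ, n ≤ 2 * t → (2 * t - n) * ‖c‖ ^ 2 ≤ t ^ 2 * ‖p y y‖ := by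
    intro t ht
    have h0 := hp (z - (t : ℂ) • y)
    have hzz : p z z = star c * p x x * c := by
      rw [hz z, ← hs x z, hz x, star_mul, hs x x]
    have hzy : p z y = star c * c := by
      rw [← hs y z, hz y, star_mul, hs y x]
    have hyz : p y z = star c * c := by
      rw [hz y, ← hs x y]
    have h1 : star c * p x x * c ≤ n • (star c * c) :=
      CStarAlgebra.star_left_conjugate_le_norm_smul (hb := hs x x)
    have h2 : p (z - (t : ℂ) • y) (z - (t : ℂ) • y)
        = star c * p x x * c - (2 * t) • (star c * c) + (t ^ 2) • p y y := by
      have e : p ((t : ℂ) • y) = (t : ℂ) • p y := by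
        rw [LinearMap.map_smulₛₗ, Complex.conj_ofReal]
      rw [map_sub (p (z - (t : ℂ) • y)), map_sub p, e]
      simp only [LinearMap.sub_apply, LinearMap.smul_apply, map_smul, hzz, hzy, hyz]
      simp only [Complex.coe_smul]
      module
    have h3 : (2 * t - n) • (star c * c) ≤ t ^ 2 • p y y := by
      rw [← sub_nonneg]
      calc 0 ≤ p (z - (t : ℂ) • y) (z - (t : ℂ) • y) := h0
        _ ≤ n • (star c * c) - (2 * t) • (star c * c) + (t ^ 2) • p y y := by
            rw [h2]; gcongr
        _ = t ^ 2 • p y y - (2 * t - n) • (star c * c) := by module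
    have h4 := CStarAlgebra.norm_le_norm_of_nonneg_of_le
      (smul_nonneg (sub_nonneg.2 ht) (star_mul_self_nonneg c)) h3
    rw [norm_smul, norm_smul, CStarRing.norm_star_mul_self, Real.norm_of_nonneg (sub_nonneg.2 ht),
      Real.norm_of_nonneg (sq_nonneg t)] at h4
    nlinarith
  rcases (norm_nonneg (p x x)).eq_or_lt with h | h
  · have hn0 : n = 0 := by rw [hn, ← h]
    rw [hn0] at key ⊢
    rw [zero_mul]
    refine le_of_forall_pos_le_add fun ε hε => ?_
    have hm := norm_nonneg (p y y)
    have := key (ε / (‖p y y‖ + 1)) (by positivity)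
    have hpos : 0 < ε / (‖p y y‖ + 1) := by positivity
    have h5 : ε / (‖p y y‖ + 1) * ‖p y y‖ ≤ ε := by
      rw [div_mul_eq_mul_div, div_le_iff₀ (by positivity)]; nlinarith
    have h6 : 2 * ‖c‖ ^ 2 ≤ ε / (‖p y y‖ + 1) * ‖p y y‖ := by
      have : ε / (‖p y y‖ + 1) * (2 * ‖c‖ ^ 2)
          ≤ ε / (‖p y y‖ + 1) * (ε / (‖p y y‖ + 1) * ‖p y y‖) := by nlinarith
      exact le_of_mul_le_mul_left this hpos
    nlinarith [sq_nonneg ‖c‖]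
  · have h' : 0 < n := h
    have := key n (by linarith)
    have : n * ‖c‖ ^ 2 ≤ n * (n * ‖p y y‖) := by nlinarith
    exact le_of_mul_le_mul_left this h'

theorem preInner_triangle (hs : ∀ x y, star (p x y) = p y x) (hp : ∀ x, 0 ≤ p x x)
    (ha : ∀ x y, ∃ z, ∀ w, p w z = p w x * p x y) (x y : V) :
    √‖p (x + y) (x + y)‖ ≤ √‖p x x‖ + √‖p y y‖ := by
  rw [Real.sqrt_le_left (by positivity)]
  have hx := Real.sq_sqrt (norm_nonneg (p x x))
  have hy := Real.sq_sqrt (norm_nonneg (p y y))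
  have h1 : ‖p x y‖ ≤ √‖p x x‖ * √‖p y y‖ := by
    rw [← Real.sqrt_mul (norm_nonneg _)]
    exact Real.le_sqrt_of_sq_le (preInner_cauchySchwarz p hs hp ha x y)
  have h2 : ‖p y x‖ = ‖p x y‖ := by rw [← hs, norm_star]
  calc ‖p (x + y) (x + y)‖ = ‖p x x + p x y + (p y x + p y y)‖ := by
        simp only [map_add, LinearMap.add_apply]; congr 1; abel
    _ ≤ ‖p x x‖ + ‖p x y‖ + (‖p y x‖ + ‖p y y‖) :=
        (norm_add_le _ _).trans (add_le_add (norm_add_le _ _) (norm_add_le _ _))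
    _ ≤ (√‖p x x‖ + √‖p y y‖) ^ 2 := by rw [h2]; nlinarith

theorem preInner_sqrt_smul (z : ℂ) (x : V) : √‖p (z • x) (z • x)‖ = ‖z‖ * √‖p x x‖ := by
  have : ‖p (z • x) (z • x)‖ = ‖z‖ ^ 2 * ‖p x x‖ := by
    simp only [LinearMap.map_smulₛₗ, LinearMap.smul_apply, map_smul, norm_smul, RCLike.norm_conj]
    ring
  rw [this, Real.sqrt_mul (sq_nonneg _), Real.sqrt_sq (norm_nonneg z)]

theorem preInner_add_le (hp : ∀ x, 0 ≤ p x x) (x y : V) :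
    p (x + y) (x + y) ≤ (2 : ℝ) • p x x + (2 : ℝ) • p y y := by
  rw [← sub_nonneg]
  convert hp (x - y) using 1
  simp only [map_add, map_sub, LinearMap.add_apply, LinearMap.sub_apply]
  module

end PreInner

namespace HilbertModule

variable (B : Type*) {E : Type*} [NonUnitalCStarAlgebra B] [PartialOrder B] [StarOrderedRing B]
  [NormedAddCommGroup E] [NormedSpace ℂ E] [CompleteSpace E] [HilbertModule B E]

/-- The `B`-valued inner product of a Hilbert `B`-module. -/
abbrev inner : E →ₗ⋆[ℂ] E →ₗ[ℂ] B := form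

theorem star_inner (x y : E) : star (inner B x y) = inner B y x := star_form x y

theorem inner_nonneg (x : E) : 0 ≤ inner B x x := form_nonneg x

variable {B} in
theorem inner_act (x y : E) (b : B) : inner B x (act y b) = inner B x y * b := form_act x y b

theorem norm_sq (x : E) : ‖x‖ ^ 2 = ‖inner B x x‖ := norm_sq_form x

theorem norm_eq (x : E) : ‖x‖ = √‖inner B x x‖ := by
  rw [← norm_sq B, Real.sqrt_sq (norm_nonneg x)]

theorem norm_inner_le (x y : E) : ‖inner B x y‖ ≤ ‖x‖ * ‖y‖ := by
  have h := preInner_cauchySchwarz (inner B (E := E)) (star_inner B) (inner_nonneg B)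
    (fun x y => ⟨act x (inner B x y), fun w => inner_act w x _⟩) x y
  rw [← norm_sq B, ← norm_sq B, ← mul_pow] at h
  exact (pow_le_pow_iff_left₀ (norm_nonneg _) (by positivity) two_ne_zero).1 h

theorem eq_zero_of_inner_self {x : E} (h : inner B x x = 0) : x = 0 := by
  rw [← norm_eq_zero, norm_eq B, h]; simp

theorem ext_inner {x y : E} (h : ∀ z, inner B z x = inner B z y) : x = y := by
  rw [← sub_eq_zero]
  apply eq_zero_of_inner_self B
  rw [map_sub, h, sub_self]

/-- The inner product as a bounded sesquilinear map. -/
noncomputable def innerSL : E →L⋆[ℂ] E →L[ℂ] B :=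
  (inner B).mkContinuous₂ 1 fun x y => by simpa using norm_inner_le B x y

theorem innerSL_apply (x y : E) : innerSL B x y = inner B x y := rfl

theorem continuous_inner : Continuous fun q : E × E => inner B q.1 q.2 := by
  simp_rw [← innerSL_apply]; fun_prop

end HilbertModule

theorem summable_of_nonneg_le {ι B : Type*} [NonUnitalCStarAlgebra B] [PartialOrder B]
    [StarOrderedRing B] {f g : ι → B} (h0 : ∀ i, 0 ≤ f i) (h : ∀ i, f i ≤ g i)
    (hg : Summable g) : Summable f := by
  rw [summable_iff_vanishing_norm] at hg ⊢
  intro ε hε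
  obtain ⟨s, hs⟩ := hg ε hε
  exact ⟨s, fun t ht => (CStarAlgebra.norm_le_norm_of_nonneg_of_le
    (Finset.sum_nonneg fun i _ => h0 i) (Finset.sum_le_sum fun i _ => h i)).trans_lt (hs t ht)⟩

theorem preInner_polarization {V B : Type*} [AddCommGroup V] [Module ℂ V] [AddCommGroup B]
    [Module ℂ B] (p : V →ₗ⋆[ℂ] V →ₗ[ℂ] B) (x y : V) :
    p x y = (1 / 2 : ℂ) • (p (x + y) (x + y) - p x x - p y y)
      + (-Complex.I / 2) • (p (x + Complex.I • y) (x + Complex.I • y) - p x x - p y y) := by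
  have e : p (Complex.I • y) = (-Complex.I) • p y := by
    rw [LinearMap.map_smulₛₗ, Complex.conj_I]
  simp only [map_add, LinearMap.add_apply, e, LinearMap.smul_apply, map_smul]
  match_scalars <;> ring_nf <;> (simp [Complex.I_sq]; try ring_nf)

section HilbertSum

open HilbertModule

variable (B : Type*) {ι : Type*} (E : ι → Type*) [NonUnitalCStarAlgebra B] [PartialOrder B]
  [StarOrderedRing B] [∀ i, NormedAddCommGroup (E i)] [∀ i, NormedSpace ℂ (E i)]
  [∀ i, CompleteSpace (E i)] [∀ i, HilbertModule B (E i)]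

/-- The families `x` for which `∑ ⟪x i, x i⟫` converges in norm in `B`. -/
def hilbertSumSubmodule : Submodule ℂ (∀ i, E i) where
  carrier := {x | Summable fun i => inner B (x i) (x i)}
  add_mem' {x y} hx hy := by
    refine summable_of_nonneg_le (fun i => inner_nonneg B _) (fun i => ?_)
      ((hx.const_smul (2 : ℝ)).add (hy.const_smul (2 : ℝ)))
    exact preInner_add_le (inner B) (inner_nonneg B) (x i) (y i)
  zero_mem' := by simp
  smul_mem' z x hx := by
    have : Summable fun i => z • (starRingEnd ℂ z) • inner B (x i) (x i) :=
      (Summable.const_smul _ hx).const_smul _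
    simpa [LinearMap.map_smulₛₗ] using this

/-- The direct sum of Hilbert `B`-modules: the families `x` for which `∑ ⟪x i, x i⟫` converges in
norm, with `⟪x, y⟫ = ∑ ⟪x i, y i⟫`. -/
def HilbertSum : Type _ := hilbertSumSubmodule B E

namespace HilbertSum

instance : AddCommGroup (HilbertSum B E) := inferInstanceAs (AddCommGroup (hilbertSumSubmodule B E))

instance : Module ℂ (HilbertSum B E) := inferInstanceAs (Module ℂ (hilbertSumSubmodule B E))

instance : CoeFun (HilbertSum B E) (fun _ => ∀ i, E i) := ⟨fun x => x.1⟩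

variable {B E}

/-- The element of the direct sum given by a family. -/
def mk (x : ∀ i, E i) (hx : Summable fun i => inner B (x i) (x i)) : HilbertSum B E := ⟨x, hx⟩

@[simp] theorem mk_apply (x : ∀ i, E i) (hx : Summable fun i => inner B (x i) (x i)) (i : ι) :
    mk x hx i = x i := rfl

@[ext] theorem ext {x y : HilbertSum B E} (h : ∀ i, x i = y i) : x = y := Subtype.ext (funext h)

@[simp] theorem add_apply (x y : HilbertSum B E) (i : ι) : (x + y) i = x i + y i := rfl
@[simp] theorem sub_apply (x y : HilbertSum B E) (i : ι) : (x - y) i = x i - y i := rfl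
@[simp] theorem zero_apply (i : ι) : (0 : HilbertSum B E) i = 0 := rfl
@[simp] theorem smul_apply (z : ℂ) (x : HilbertSum B E) (i : ι) : (z • x) i = z • x i := rfl

theorem summable_self (x : HilbertSum B E) : Summable fun i => inner B (x i) (x i) := x.2

theorem summable_inner (x y : HilbertSum B E) : Summable fun i => inner B (x i) (y i) := by
  have h1 := ((x + y).summable_self.sub x.summable_self).sub y.summable_self
  have h2 := ((x + Complex.I • y).summable_self.sub x.summable_self).sub y.summable_self
  have h3 := (h1.const_smul (1 / 2 : ℂ)).add (h2.const_smul (-Complex.I / 2 : ℂ))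
  refine h3.congr fun i => ?_
  exact (preInner_polarization (inner B) (x i) (y i)).symm

variable (B E) in
/-- The inner product of the direct sum. -/
noncomputable def form : HilbertSum B E →ₗ⋆[ℂ] HilbertSum B E →ₗ[ℂ] B :=
  LinearMap.mk₂'ₛₗ (starRingEnd ℂ) (RingHom.id ℂ) (fun x y => ∑' i, inner B (x i) (y i))
    (fun x y z => by
      simpa using (summable_inner x z).tsum_add (summable_inner y z))
    (fun c x y => by
      simpa [LinearMap.map_smulₛₗ] using (summable_inner x y).tsum_const_smul (starRingEnd ℂ c))
    (fun x y z => by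
      simpa using (summable_inner x y).tsum_add (summable_inner x z))
    (fun c x y => by simpa using (summable_inner x y).tsum_const_smul c)

theorem form_apply (x y : HilbertSum B E) : form B E x y = ∑' i, inner B (x i) (y i) := rfl

theorem hasSum_form (x y : HilbertSum B E) :
    HasSum (fun i => inner B (x i) (y i)) (form B E x y) := (summable_inner x y).hasSum

theorem star_form (x y : HilbertSum B E) : star (form B E x y) = form B E y x := by
  refine HasSum.unique ?_ (hasSum_form y x)
  simpa [star_inner] using (hasSum_form x y).star

theorem form_nonneg (x : HilbertSum B E) : 0 ≤ form B E x x :=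
  tsum_nonneg fun i => inner_nonneg B (x i)

theorem inner_act_self (x : ∀ i, E i) (b : B) (i : ι) :
    inner B (act (x i) b) (act (x i) b) = star b * inner B (x i) (x i) * b := by
  rw [inner_act, ← star_inner, inner_act, star_mul, star_inner]

variable (B E) in
/-- The action of `B` on the direct sum. -/
noncomputable def act : HilbertSum B E →ₗ[ℂ] B →ₗ[ℂ] HilbertSum B E :=
  LinearMap.mk₂ ℂ (fun x b => mk (fun i => HilbertModule.act (x i) b) (by
      simp_rw [inner_act_self]
      exact (x.summable_self.mul_left _).mul_right _))
    (fun x y b => by ext i; exact LinearMap.map_add₂ _ _ _ _)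
    (fun c x b => by ext i; exact LinearMap.map_smul₂ _ _ _ _)
    (fun x b b' => by ext i; exact map_add _ _ _)
    (fun c x b => by ext i; exact map_smul _ _ _)

theorem act_apply (x : HilbertSum B E) (b : B) (i : ι) :
    act B E x b i = HilbertModule.act (x i) b := rfl

theorem form_act (x y : HilbertSum B E) (b : B) :
    form B E x (act B E y b) = form B E x y * b := by
  refine HasSum.unique (hasSum_form x _) ?_
  simpa [act_apply, inner_act] using (hasSum_form x y).mul_right b

noncomputable instance : NormedAddCommGroup (HilbertSum B E) :=
  AddGroupNorm.toNormedAddCommGroup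
    { toFun := fun x => √‖form B E x x‖
      map_zero' := by simp
      add_le' := preInner_triangle (form B E) star_form form_nonneg
        fun x y => ⟨act B E x (form B E x y), fun w => form_act w x _⟩
      neg' := fun a => by simp
      eq_zero_of_map_eq_zero' := fun x hx => by
        rw [Real.sqrt_eq_zero (norm_nonneg _), norm_eq_zero] at hx
        have h := hasSum_form x x
        rw [hx, hasSum_zero_iff_of_nonneg fun i => inner_nonneg B (x i)] at h
        ext i
        exact eq_zero_of_inner_self B (congrFun h i) }

theorem norm_sq (x : HilbertSum B E) : ‖x‖ ^ 2 = ‖form B E x x‖ :=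
  Real.sq_sqrt (norm_nonneg _)

noncomputable instance : NormedSpace ℂ (HilbertSum B E) where
  norm_smul_le z x := (preInner_sqrt_smul (form B E) z x).le

theorem norm_sum_le (x : HilbertSum B E) (s : Finset ι) :
    ‖∑ i ∈ s, inner B (x i) (x i)‖ ≤ ‖x‖ ^ 2 := by
  rw [norm_sq]
  exact CStarAlgebra.norm_le_norm_of_nonneg_of_le
    (Finset.sum_nonneg fun i _ => inner_nonneg B (x i))
    (sum_le_hasSum s (fun i _ => inner_nonneg B (x i)) (hasSum_form x x))

theorem norm_apply_le (x : HilbertSum B E) (i : ι) : ‖x i‖ ≤ ‖x‖ := by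
  have := norm_sum_le x {i}
  rw [Finset.sum_singleton, ← HilbertModule.norm_sq] at this
  exact (pow_le_pow_iff_left₀ (norm_nonneg _) (norm_nonneg _) two_ne_zero).1 this

theorem norm_sum_sub_le {x y : ∀ i, E i} (s : Finset ι) :
    ‖∑ i ∈ s, inner B (x i) (x i)‖ ≤ 2 * ‖∑ i ∈ s, inner B (x i - y i) (x i - y i)‖
      + 2 * ‖∑ i ∈ s, inner B (y i) (y i)‖ := by
  have h : ∑ i ∈ s, inner B (x i) (x i) ≤ (2 : ℝ) • ∑ i ∈ s, inner B (x i - y i) (x i - y i)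
      + (2 : ℝ) • ∑ i ∈ s, inner B (y i) (y i) := by
    rw [Finset.smul_sum, Finset.smul_sum, ← Finset.sum_add_distrib]
    refine Finset.sum_le_sum fun i _ => ?_
    simpa using preInner_add_le (inner B) (inner_nonneg B) (x i - y i) (y i)
  refine (CStarAlgebra.norm_le_norm_of_nonneg_of_le
    (Finset.sum_nonneg fun i _ => inner_nonneg B (x i)) h).trans ((norm_add_le _ _).trans ?_)
  simp [norm_smul]

instance : CompleteSpace (HilbertSum B E) := by
  refine Metric.complete_of_cauchySeq_tendsto fun u hu => ?_
  have hcau : ∀ i, CauchySeq fun n => u n i := fun i => by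
    rw [Metric.cauchySeq_iff] at hu ⊢
    intro ε hε
    obtain ⟨N, hN⟩ := hu ε hε
    refine ⟨N, fun m hm n hn => lt_of_le_of_lt ?_ (hN m hm n hn)⟩
    rw [dist_eq_norm, dist_eq_norm]
    exact norm_apply_le (u m - u n) i
  choose y hy using fun i => cauchySeq_tendsto_of_complete (hcau i)
  have hbound : ∀ ε > 0, ∃ N, ∀ n ≥ N, ∀ s : Finset ι,
      ‖∑ i ∈ s, inner B (y i - u n i) (y i - u n i)‖ ≤ ε ^ 2 := by
    intro ε hε
    obtain ⟨N, hN⟩ := Metric.cauchySeq_iff.1 hu ε hε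
    refine ⟨N, fun n hn s => ?_⟩
    have hlim : Filter.Tendsto (fun m => ‖∑ i ∈ s, inner B (u m i - u n i) (u m i - u n i)‖)
        Filter.atTop (nhds ‖∑ i ∈ s, inner B (y i - u n i) (y i - u n i)‖) := by
      refine (tendsto_finsetSum _ fun i _ => ?_).norm
      have h1 : Filter.Tendsto (fun m => u m i - u n i) Filter.atTop (nhds (y i - u n i)) :=
        (hy i).sub_const _
      exact ((continuous_inner B).tendsto _).comp (h1.prodMk_nhds h1)
    refine le_of_tendsto hlim (Filter.eventually_atTop.2 ⟨N, fun m hm => ?_⟩)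
    refine (norm_sum_le (u m - u n) s).trans ?_
    have := hN m hm n hn
    rw [dist_eq_norm] at this
    gcongr
  have hmem : Summable fun i => inner B (y i) (y i) := by
    rw [summable_iff_vanishing_norm]
    intro ε hε
    obtain ⟨N, hN⟩ := hbound (√(ε / 8)) (Real.sqrt_pos.2 (by positivity))
    obtain ⟨s, hs⟩ := summable_iff_vanishing_norm.1 (u N).summable_self (ε / 8) (by positivity)
    refine ⟨s, fun t ht => ?_⟩
    have h1 := hN N le_rfl t
    rw [Real.sq_sqrt (by positivity)] at h1
    have h2 := hs t ht
    have h3 := norm_sum_sub_le (B := B) (x := y) (y := u N) t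
    linarith
  refine ⟨mk y hmem, Metric.tendsto_atTop.2 fun ε hε => ?_⟩
  obtain ⟨N, hN⟩ := hbound (ε / 2) (by positivity)
  refine ⟨N, fun n hn => ?_⟩
  rw [dist_comm, dist_eq_norm]
  refine lt_of_le_of_lt ?_ (half_lt_self hε)
  refine (pow_le_pow_iff_left₀ (norm_nonneg _) (by positivity) two_ne_zero).1 ?_
  rw [norm_sq]
  have hl : Filter.Tendsto (fun s : Finset ι => ∑ i ∈ s,
      inner B ((mk y hmem - u n) i) ((mk y hmem - u n) i)) Filter.atTop
      (nhds (form B E (mk y hmem - u n) (mk y hmem - u n))) := by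
    simpa only [HasSum, SummationFilter.unconditional_filter] using
      hasSum_form (mk y hmem - u n) (mk y hmem - u n)
  exact le_of_tendsto hl.norm (Filter.Eventually.of_forall fun s => hN n hn s)

noncomputable instance : HilbertModule B (HilbertSum B E) where
  form := form B E
  act := act B E
  star_form := star_form
  form_nonneg := form_nonneg
  form_act := form_act
  norm_sq_form := norm_sq

theorem hasSum_inner (x y : HilbertSum B E) :
    HasSum (fun i => inner B (x i) (y i)) (inner B x y) := hasSum_form x y

end HilbertSum
end HilbertSum

section Adjointable

open HilbertModule

variable (B E : Type*) [NonUnitalCStarAlgebra B] [PartialOrder B] [StarOrderedRing B]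
  [NormedAddCommGroup E] [NormedSpace ℂ E] [CompleteSpace E] [HilbertModule B E]

/-- The adjointable operators on a Hilbert `B`-module `E`. -/
def adjointableSubalgebra : Subalgebra ℂ (E →L[ℂ] E) where
  carrier := {T | ∃ S : E →L[ℂ] E, ∀ x y, inner B (T x) y = inner B x (S y)}
  mul_mem' := by
    rintro T₁ T₂ ⟨S₁, h₁⟩ ⟨S₂, h₂⟩
    exact ⟨S₂ * S₁, fun x y => by simp [h₁, h₂]⟩
  add_mem' := by
    rintro T₁ T₂ ⟨S₁, h₁⟩ ⟨S₂, h₂⟩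
    exact ⟨S₁ + S₂, fun x y => by simp [h₁, h₂]⟩
  algebraMap_mem' z := ⟨(starRingEnd ℂ z) • 1, fun x y => by
    simp [Algebra.algebraMap_eq_smul_one, LinearMap.map_smulₛₗ]⟩

/-- The C⋆-algebra `𝓛(E)` of adjointable operators on a Hilbert `B`-module `E`, with the operator
norm. -/
def Adjointable : Type _ := adjointableSubalgebra B E

namespace Adjointable

variable {B E}

noncomputable instance : NormedRing (Adjointable B E) :=
  inferInstanceAs (NormedRing (adjointableSubalgebra B E))

noncomputable instance : NormedAlgebra ℂ (Adjointable B E) :=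
  inferInstanceAs (NormedAlgebra ℂ (adjointableSubalgebra B E))

theorem norm_def (T : Adjointable B E) : ‖T‖ = ‖T.1‖ := rfl

@[simp] theorem mul_apply (S T : Adjointable B E) (x : E) : (S * T).1 x = S.1 (T.1 x) := rfl
@[simp] theorem one_apply (x : E) : (1 : Adjointable B E).1 x = x := rfl
@[simp] theorem add_apply (S T : Adjointable B E) (x : E) : (S + T).1 x = S.1 x + T.1 x := rfl
@[simp] theorem smul_apply (z : ℂ) (T : Adjointable B E) (x : E) : (z • T).1 x = z • T.1 x := rfl

theorem le_norm (T : Adjointable B E) (x : E) : ‖T.1 x‖ ≤ ‖T‖ * ‖x‖ := T.1.le_opNorm x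

@[ext] theorem ext {S T : Adjointable B E} (h : ∀ x, S.1 x = T.1 x) : S = T :=
  Subtype.ext (ContinuousLinearMap.ext h)

theorem isometry_val : Isometry (fun T : Adjointable B E => T.1) := fun _ _ => rfl

/-- The adjoint of an adjointable operator. -/
noncomputable instance : Star (Adjointable B E) where
  star T := ⟨T.2.choose, T.1, fun x y => by
    rw [← star_inner, ← T.2.choose_spec, star_inner]⟩

theorem inner_star_right (T : Adjointable B E) (x y : E) :
    inner B (T.1 x) y = inner B x ((star T).1 y) := T.2.choose_spec x y

theorem inner_star_left (T : Adjointable B E) (x y : E) :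
    inner B ((star T).1 x) y = inner B x (T.1 y) := by
  rw [← star_inner, ← inner_star_right, star_inner]

theorem ext_inner {S T : Adjointable B E}
    (h : ∀ x y, inner B x (S.1 y) = inner B x (T.1 y)) : S = T :=
  Subtype.ext (ContinuousLinearMap.ext fun y => HilbertModule.ext_inner B fun x => h x y)

/-- An operator with a formal adjoint. -/
def mk (T S : E →L[ℂ] E) (h : ∀ x y, inner B (T x) y = inner B x (S y)) : Adjointable B E :=
  ⟨T, S, h⟩

theorem star_mk (T S : E →L[ℂ] E) (h : ∀ x y, inner B (T x) y = inner B x (S y)) :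
    (star (mk T S h)).1 = S := by
  refine ContinuousLinearMap.ext fun y => HilbertModule.ext_inner B fun x => ?_
  rw [← inner_star_right]
  exact h x y

noncomputable instance : StarRing (Adjointable B E) where
  star_involutive T := ext_inner fun x y => by rw [← inner_star_right, inner_star_left]
  star_mul S T := ext_inner fun x y => by
    rw [← inner_star_right]
    change inner B (S.1 (T.1 x)) y = inner B x ((star T).1 ((star S).1 y))
    rw [inner_star_right, inner_star_right]
  star_add S T := ext_inner fun x y => by
    rw [← inner_star_right]
    change inner B (S.1 x + T.1 x) y = inner B x ((star S).1 y + (star T).1 y)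
    simp only [map_add, LinearMap.add_apply, inner_star_right]

instance : StarModule ℂ (Adjointable B E) where
  star_smul z T := ext_inner fun x y => by
    rw [← inner_star_right]
    change inner B (z • T.1 x) y = inner B x (starRingEnd ℂ z • (star T).1 y)
    simp only [map_smul, LinearMap.map_smulₛₗ, LinearMap.smul_apply, inner_star_right]

instance : CStarRing (Adjointable B E) where
  norm_mul_self_le T := by
    have h : ‖T‖ ≤ √‖star T * T‖ := by
      refine ContinuousLinearMap.opNorm_le_bound _ (Real.sqrt_nonneg _) fun x => ?_
      change ‖T.1 x‖ ≤ _
      refine (pow_le_pow_iff_left₀ (norm_nonneg _) (by positivity) two_ne_zero).1 ?_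
      rw [norm_sq B, inner_star_right, mul_pow, Real.sq_sqrt (norm_nonneg _)]
      calc _ ≤ ‖x‖ * ‖(star T * T).1 x‖ := norm_inner_le B _ _
        _ ≤ ‖x‖ * (‖star T * T‖ * ‖x‖) := by gcongr; exact (star T * T).le_norm x
        _ = _ := by ring
    calc ‖T‖ * ‖T‖ ≤ √‖star T * T‖ * √‖star T * T‖ := by gcongr
      _ = _ := Real.mul_self_sqrt (norm_nonneg _)

instance : CompleteSpace (Adjointable B E) := by
  refine Metric.complete_of_cauchySeq_tendsto fun u hu => ?_
  have hv : CauchySeq fun n => star (u n) := by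
    have : ∀ m n, dist (star (u m)) (star (u n)) = dist (u m) (u n) := fun m n => by
      rw [dist_eq_norm, dist_eq_norm, ← star_sub, norm_star]
    rw [Metric.cauchySeq_iff] at hu ⊢
    simpa only [this] using hu
  obtain ⟨T, hT⟩ := cauchySeq_tendsto_of_complete
    (isometry_val.uniformContinuous.comp_cauchySeq hu)
  obtain ⟨S, hS⟩ := cauchySeq_tendsto_of_complete
    (isometry_val.uniformContinuous.comp_cauchySeq hv)
  have happ : ∀ {w : ℕ → E →L[ℂ] E} {R : E →L[ℂ] E}, Filter.Tendsto w Filter.atTop (nhds R) →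
      ∀ x, Filter.Tendsto (fun n => w n x) Filter.atTop (nhds (R x)) := fun h x =>
    ((ContinuousLinearMap.apply ℂ E x).continuous.tendsto _).comp h
  refine ⟨mk T S fun x y => ?_, isometry_val.isUniformInducing.isInducing.tendsto_nhds_iff.2 hT⟩
  have h1 := ((continuous_inner B).tendsto (T x, y)).comp
    ((happ hT x).prodMk_nhds (tendsto_const_nhds (x := y)))
  have h2 := ((continuous_inner B).tendsto (x, S y)).comp
    ((tendsto_const_nhds (x := x)).prodMk_nhds (happ hS y))
  refine tendsto_nhds_unique h1 (h2.congr fun n => ?_)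
  exact (inner_star_right (u n) x y).symm

noncomputable instance : CStarAlgebra (Adjointable B E) where

/-- `‖T‖² - T⋆ T` is of the form `R⋆ R`. -/
theorem exists_sub_star_mul (T : Adjointable B E) : ∃ R : Adjointable B E,
    ∀ x y, inner B (T.1 x) (T.1 y) + inner B (R.1 x) (R.1 y)
      = ((‖T‖ ^ 2 : ℝ) : ℂ) • inner B x y := by
  let _ := CStarAlgebra.spectralOrder (Adjointable B E)
  have := CStarAlgebra.spectralOrderedRing (Adjointable B E)
  have h : 0 ≤ algebraMap ℝ (Adjointable B E) ‖star T * T‖ - star T * T :=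
    sub_nonneg.2 (IsSelfAdjoint.star_mul_self T).le_algebraMap_norm_self
  obtain ⟨R, hR⟩ := CStarAlgebra.nonneg_iff_eq_star_mul_self.1 h
  refine ⟨R, fun x y => ?_⟩
  have e : star T * T + star R * R = ((‖T‖ ^ 2 : ℝ) : ℂ) • (1 : Adjointable B E) := by
    rw [← hR, CStarRing.norm_star_mul_self, ← sq, Algebra.algebraMap_eq_smul_one, add_sub_cancel]
    exact (Complex.coe_smul (E := Adjointable B E) (‖T‖ ^ 2) 1).symm
  have := congrArg (fun Q : Adjointable B E => inner B x (Q.1 y)) e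
  simp only [inner_star_right]
  simpa using this

end Adjointable

end Adjointable

namespace FellBundle

variable {G : Type u} [Group G] (A : FellBundle.{u, v} G)

/-- Every fiber is a Hilbert module over the unit fiber, with `⟪a, b⟫ = a⋆ b`. -/
noncomputable instance instHilbertModule (t : G) : HilbertModule (A.fiber 1) (A.fiber t) where
  form := A.inner t
  act := A.mul (mul_one t)
  star_form := A.star_inner
  form_nonneg := A.inner_nonneg
  form_act := A.inner_mul
  norm_sq_form a := (A.norm_inner_self a).symm

/-- `ℓ²(A)`: the sections `ξ` of the Fell bundle for which `∑ ξ(t)⋆ ξ(t)` converges in norm in the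
unit fiber, a Hilbert module over the unit fiber with `⟪ξ, η⟫ = ∑ ξ(t)⋆ η(t)`. -/
abbrev ell2 : Type _ := HilbertSum (A.fiber 1) A.fiber

theorem inner_eq {t : G} (a b : A.fiber t) :
    HilbertModule.inner (A.fiber 1) a b = A.inner t a b := rfl

theorem inner_mul_left {r s t r' : G} (h : r * s = t) (hr : r⁻¹ = r') (h' : r' * t = s)
    (a : A.fiber r) (x : A.fiber s) (y : A.fiber t) :
    A.inner t (A.mul h a x) y = A.inner s x (A.mul h' (A.star hr a) y) := by
  subst hr
  rw [inner_def, inner_def, A.star_mul h rfl rfl rfl (by rw [← h, mul_inv_rev]),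
    A.mul_assoc _ _ h']

theorem inner_mul_self_le {r s t : G} (h : r * s = t) (a : A.fiber r) (x : A.fiber s) :
    A.inner t (A.mul h a x) (A.mul h a x) ≤ (‖a‖ ^ 2) • A.inner s x x := by
  set b := A.inner r a a with hb
  have hb0 : 0 ≤ b := A.inner_nonneg a
  have e1 : A.inner t (A.mul h a x) (A.mul h a x) = A.inner s x (A.mul (one_mul s) b x) := by
    rw [A.inner_mul_left h rfl (by rw [← h, inv_mul_cancel_left]), hb, inner_def (t := r),
      A.mul_assoc _ _ h]
  have e2 : ‖a‖ ^ 2 = ‖b‖ := (A.norm_inner_self a).symm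
  let _ := CStarAlgebra.spectralOrder (Unitization ℂ (A.fiber 1))
  have := CStarAlgebra.spectralOrderedRing (Unitization ℂ (A.fiber 1))
  have hsa : IsSelfAdjoint (b : Unitization ℂ (A.fiber 1)) := by
    have := IsSelfAdjoint.of_nonneg hb0
    exact this.inr ℂ
  have h1 := sub_nonneg.2 hsa.le_algebraMap_norm_self
  obtain ⟨R, hR⟩ := CStarAlgebra.nonneg_iff_eq_star_mul_self.1 h1
  set z : ℂ := R.fst with hz
  set c : A.fiber 1 := R.snd with hc
  rw [Algebra.algebraMap_eq_smul_one, Unitization.norm_inr, sub_eq_add_neg] at hR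
  have hfst : ((‖b‖ : ℝ) : ℂ) = starRingEnd ℂ z * z := by
    have := congrArg (fun Q : Unitization ℂ (A.fiber 1) => Q.fst) hR
    simpa using! this
  have hsnd : -b = starRingEnd ℂ z • c + z • star c + star c * c := by
    have := congrArg (fun Q : Unitization ℂ (A.fiber 1) => Q.snd) hR
    simpa using! this
  have hy := A.inner_nonneg (z • x + A.mul (one_mul s) c x)
  have e3 : A.inner s (z • x + A.mul (one_mul s) c x) (z • x + A.mul (one_mul s) c x)
      = (starRingEnd ℂ z * z) • A.inner s x x
        + A.inner s x (A.mul (one_mul s) (starRingEnd ℂ z • c + z • star c + star c * c) x) := by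
    have f1 : A.inner s (z • x) = starRingEnd ℂ z • A.inner s x := LinearMap.map_smulₛₗ _ _ _
    have f2 : ∀ w, A.inner s (A.mul (one_mul s) c x) w
        = A.inner s x (A.mul (one_mul s) (star c) w) := fun w =>
      A.inner_mul_left (one_mul s) inv_one (one_mul s) c x w
    have f3 : A.mul (one_mul s) (star c) (A.mul (one_mul s) c x)
        = A.mul (one_mul s) (star c * c) x := (A.mul_assoc _ _ _ _ _ _ _).symm
    simp only [map_add, LinearMap.add_apply, f1, f2, f3, map_smul, LinearMap.smul_apply]
    module
  rw [e3, ← hfst, ← hsnd, map_neg, LinearMap.neg_apply, map_neg, ← sub_eq_add_neg, sub_nonneg,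
    Complex.coe_smul] at hy
  rw [e1, e2]
  exact hy

/-- Left multiplication by `a`, as a linear map of sections: `(a ξ)(s) = a ξ(t⁻¹ s)` for `a` in the
fiber over `t`. -/
noncomputable def leftMul {t : G} (a : A.fiber t) : (∀ s, A.fiber s) →ₗ[ℂ] (∀ s, A.fiber s) where
  toFun ξ s := A.mul (mul_inv_cancel_left t s) a (ξ (t⁻¹ * s))
  map_add' ξ η := by ext s; simp
  map_smul' z ξ := by ext s; simp

theorem hasSum_shift (t : G) (ξ : A.ell2) :
    HasSum (fun s => A.inner (t⁻¹ * s) (ξ (t⁻¹ * s)) (ξ (t⁻¹ * s)))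
      (HilbertModule.inner (A.fiber 1) ξ ξ) :=
  (Equiv.mulLeft t⁻¹).hasSum_iff.2 (HilbertSum.hasSum_inner ξ ξ)

theorem summable_leftMul {t : G} (a : A.fiber t) (ξ : A.ell2) :
    Summable fun s => HilbertModule.inner (A.fiber 1) (A.leftMul a ξ.1 s) (A.leftMul a ξ.1 s) :=
  summable_of_nonneg_le (fun _ => A.inner_nonneg _) (fun _ => A.inner_mul_self_le _ a _)
    ((A.hasSum_shift t ξ).summable.const_smul (‖a‖ ^ 2))

/-- The operator `Λ(a)` on `ℓ²(A)`, `(Λ(a) ξ)(s) = a ξ(t⁻¹ s)` for `a` in the fiber over `t`. -/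
noncomputable def lambdaCLM {t : G} (a : A.fiber t) : A.ell2 →L[ℂ] A.ell2 :=
  LinearMap.mkContinuous
    { toFun := fun ξ => HilbertSum.mk (A.leftMul a ξ.1) (A.summable_leftMul a ξ)
      map_add' := fun ξ η => by ext s; exact congrFun ((A.leftMul a).map_add ξ.1 η.1) s
      map_smul' := fun z ξ => by ext s; exact congrFun ((A.leftMul a).map_smul z ξ.1) s }
    ‖a‖ fun ξ => by
      refine (pow_le_pow_iff_left₀ (norm_nonneg _) (by positivity) two_ne_zero).1 ?_
      rw [mul_pow, HilbertModule.norm_sq (A.fiber 1) ξ, HilbertModule.norm_sq (A.fiber 1)]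
      have h := hasSum_le (fun s => A.inner_mul_self_le (mul_inv_cancel_left t s) a (ξ (t⁻¹ * s)))
        (HilbertSum.hasSum_inner (HilbertSum.mk (A.leftMul a ξ.1) (A.summable_leftMul a ξ))
          (HilbertSum.mk (A.leftMul a ξ.1) (A.summable_leftMul a ξ)))
        ((A.hasSum_shift t ξ).const_smul (‖a‖ ^ 2))
      refine (CStarAlgebra.norm_le_norm_of_nonneg_of_le (HilbertModule.inner_nonneg _ _) h).trans ?_
      rw [norm_smul, Real.norm_of_nonneg (sq_nonneg _)]

theorem lambdaCLM_apply {t : G} (a : A.fiber t) (ξ : A.ell2) (s : G) :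
    A.lambdaCLM a ξ s = A.mul (mul_inv_cancel_left t s) a (ξ (t⁻¹ * s)) := rfl

theorem mul_section_congr {t s₁ s₂ r : G} (a : A.fiber t) (ξ : ∀ s, A.fiber s) (e : s₁ = s₂)
    (h₁ : t * s₁ = r) (h₂ : t * s₂ = r) : A.mul h₁ a (ξ s₁) = A.mul h₂ a (ξ s₂) := by
  subst e; rfl

theorem inner_lambdaCLM {t : G} (a : A.fiber t) (ξ η : A.ell2) :
    HilbertModule.inner (A.fiber 1) (A.lambdaCLM a ξ) η
      = HilbertModule.inner (A.fiber 1) ξ (A.lambdaCLM (A.star rfl a) η) := by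
  have h1 := (Equiv.mulLeft t).hasSum_iff.2 (HilbertSum.hasSum_inner (A.lambdaCLM a ξ) η)
  have h2 : ((fun s => HilbertModule.inner (A.fiber 1) (A.lambdaCLM a ξ s) (η s)) ∘
      (Equiv.mulLeft t : G → G))
      = fun u => HilbertModule.inner (A.fiber 1) (ξ u) (A.lambdaCLM (A.star rfl a) η u) := by
    funext u
    have k : A.inner (t * u) (A.mul (mul_inv_cancel_left t (t * u)) a (ξ.1 (t⁻¹ * (t * u))))
          (η.1 (t * u))
        = A.inner u (ξ.1 u) (A.mul (mul_inv_cancel_left t⁻¹ u) (A.star rfl a)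
          (η.1 (t⁻¹⁻¹ * u))) := by
      rw [A.mul_section_congr a ξ.1 (inv_mul_cancel_left t u) _ rfl,
        A.mul_section_congr (A.star rfl a) η.1 (congrArg (· * u) (inv_inv t)) _
          (inv_mul_cancel_left t u),
        A.inner_mul_left rfl rfl (inv_mul_cancel_left t u)]
    exact k
  rw [h2] at h1
  exact h1.unique (HilbertSum.hasSum_inner ξ (A.lambdaCLM (A.star rfl a) η))

/-- The left regular representation `Λ` of the Fell bundle by adjointable operators on `ℓ²(A)`. -/
noncomputable def lambda {t : G} (a : A.fiber t) : Adjointable (A.fiber 1) A.ell2 :=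
  Adjointable.mk (A.lambdaCLM a) (A.lambdaCLM (A.star rfl a)) (A.inner_lambdaCLM a)

/-- The reduced cross-sectional C⋆-algebra `C⋆ᵣ(A)`: the C⋆-subalgebra of `𝓛(ℓ²(A))` generated by
the operators `Λ(a)`. -/
noncomputable def reducedCStar : NonUnitalStarSubalgebra ℂ (Adjointable (A.fiber 1) A.ell2) :=
  (NonUnitalStarAlgebra.adjoin ℂ {T | ∃ (t : G) (a : A.fiber t), T = A.lambda a}).topologicalClosure

end FellBundle

section FellTensor

variable {G : Type u} [Group G] {H : Type u'} [Group H] {A : FellBundle.{u, v} G}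
  {B : FellBundle.{u', v'} H}

namespace CStarNorm

variable (α : CStarNorm (A.toStarBundle.algTensor B.toStarBundle))

/-- The algebraic tensor product of two Fell bundles with the C⋆-norm `α`, a pre-Fell bundle. -/
noncomputable def preTensor : PreFellBundle.{max u u', max v v'} (G × H) :=
  ⟨A.toStarBundle.algTensor B.toStarBundle, α⟩

/-- The tensor product `A ⊗_α B` of Fell bundles: the completion of `A ⊙ B` for the C⋆-norm `α`. -/
noncomputable def tensor : FellBundle.{max u u', max v v'} (G × H) := α.preTensor.completion

/-- The inclusion of `A_t ⊙ B_s` in the fiber of `A ⊗_α B` over `(t, s)`. -/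
noncomputable def incl (p : G × H) : A.fiber p.1 ⊗[ℂ] B.fiber p.2 →ₗ[ℂ] α.tensor.fiber p :=
  (α.preTensor.toCompletion p).toLinearMap

/-- The element `a ⊗ b` of the fiber of `A ⊗_α B` over `(t, s)`. -/
noncomputable def tmul {t : G} {s : H} (a : A.fiber t) (b : B.fiber s) : α.tensor.fiber (t, s) :=
  α.incl (t, s) (a ⊗ₜ[ℂ] b)

theorem norm_incl {p : G × H} (x : A.fiber p.1 ⊗[ℂ] B.fiber p.2) : ‖α.incl p x‖ = α.norm x :=
  (α.preTensor.toCompletion p).norm_map x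

theorem tensor_inner_incl {p : G × H} (x y : A.fiber p.1 ⊗[ℂ] B.fiber p.2) :
    α.tensor.inner p (α.incl p x) (α.incl p y)
      = α.incl 1 ((A.toStarBundle.algTensor B.toStarBundle).inner p x y) :=
  α.preTensor.toCompletion_inner x y

theorem tensor_mul_incl {p q r : G × H} (h : p * q = r) (x : A.fiber p.1 ⊗[ℂ] B.fiber p.2)
    (y : A.fiber q.1 ⊗[ℂ] B.fiber q.2) : α.tensor.mul h (α.incl p x) (α.incl q y)
      = α.incl r ((A.toStarBundle.algTensor B.toStarBundle).mul h x y) :=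
  α.preTensor.toCompletion_mul h x y

theorem algTensor_inner_tmul {p : G × H} (a a' : A.fiber p.1) (b b' : B.fiber p.2) :
    (A.toStarBundle.algTensor B.toStarBundle).inner p (a ⊗ₜ[ℂ] b) (a' ⊗ₜ[ℂ] b')
      = A.inner p.1 a a' ⊗ₜ[ℂ] B.inner p.2 b b' := rfl

/-- `a ⊗ b` for `a`, `b` in the unit fibers. -/
noncomputable def unitTmul : A.fiber 1 →ₗ[ℂ] B.fiber 1 →ₗ[ℂ] α.tensor.fiber 1 :=
  (TensorProduct.mk ℂ (A.fiber 1) (B.fiber 1)).compr₂ (α.incl 1)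

theorem unitTmul_mul (a a' : A.fiber 1) (b b' : B.fiber 1) :
    α.unitTmul a b * α.unitTmul a' b' = α.unitTmul (a * a') (b * b') :=
  α.tensor_mul_incl (mul_one 1) (a ⊗ₜ[ℂ] b) (a' ⊗ₜ[ℂ] b')

theorem star_unitTmul (a : A.fiber 1) (b : B.fiber 1) :
    star (α.unitTmul a b) = α.unitTmul (star a) (star b) :=
  α.preTensor.toCompletion_star inv_one (a ⊗ₜ[ℂ] b)

theorem unitTmul_nonneg {a : A.fiber 1} {b : B.fiber 1} (ha : 0 ≤ a) (hb : 0 ≤ b) :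
    0 ≤ α.unitTmul a b := by
  obtain ⟨c, rfl⟩ := CStarAlgebra.nonneg_iff_eq_star_mul_self.1 ha
  obtain ⟨d, rfl⟩ := CStarAlgebra.nonneg_iff_eq_star_mul_self.1 hb
  rw [← unitTmul_mul, ← star_unitTmul]
  exact star_mul_self_nonneg _

theorem unitTmul_mono {a a' : A.fiber 1} {b b' : B.fiber 1} (ha : 0 ≤ a) (hb : 0 ≤ b)
    (ha' : a ≤ a') (hb' : b ≤ b') : α.unitTmul a b ≤ α.unitTmul a' b' := by
  have h1 := α.unitTmul_nonneg (sub_nonneg.2 ha') (hb.trans hb')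
  have h2 := α.unitTmul_nonneg ha (sub_nonneg.2 hb')
  rw [map_sub, LinearMap.sub_apply, sub_nonneg] at h1
  rw [map_sub, sub_nonneg] at h2
  exact h2.trans h1

theorem sq_le_norm_smul {C : Type*} [NonUnitalCStarAlgebra C] [PartialOrder C] [StarOrderedRing C]
    {a : C} (ha : 0 ≤ a) : a * a ≤ ‖a‖ • a := by
  obtain ⟨c, rfl⟩ := CStarAlgebra.nonneg_iff_eq_star_mul_self.1 ha
  have h := CStarAlgebra.star_left_conjugate_le_norm_smul (a := c) (hb := IsSelfAdjoint.mul_star_self c)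
  rw [CStarRing.norm_self_mul_star, ← CStarRing.norm_star_mul_self] at h
  simpa only [mul_assoc] using h

theorem norm_unitTmul_le_of_nonneg {a : A.fiber 1} {b : B.fiber 1} (ha : 0 ≤ a) (hb : 0 ≤ b) :
    ‖α.unitTmul a b‖ ≤ ‖a‖ * ‖b‖ := by
  have haa : 0 ≤ a * a := by
    simpa [(IsSelfAdjoint.of_nonneg ha).star_eq] using star_mul_self_nonneg a
  have hbb : 0 ≤ b * b := by
    simpa [(IsSelfAdjoint.of_nonneg hb).star_eq] using star_mul_self_nonneg b
  have h := CStarAlgebra.norm_le_norm_of_nonneg_of_le (α.unitTmul_nonneg haa hbb)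
    (α.unitTmul_mono haa hbb (sq_le_norm_smul ha) (sq_le_norm_smul hb))
  have hs : star (α.unitTmul a b) = α.unitTmul a b :=
    (IsSelfAdjoint.of_nonneg (α.unitTmul_nonneg ha hb)).star_eq
  have h2 := CStarRing.norm_star_mul_self (x := α.unitTmul a b)
  rw [hs, unitTmul_mul] at h2
  have e : α.unitTmul (‖a‖ • a) (‖b‖ • b) = ((‖a‖ : ℂ) * (‖b‖ : ℂ)) • α.unitTmul a b := by
    rw [← Complex.coe_smul, ← Complex.coe_smul, map_smul, map_smul, LinearMap.smul_apply, smul_smul,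
      mul_comm]
  rw [h2, e, _root_.norm_smul] at h
  simp only [norm_mul, Complex.norm_real, norm_norm] at h
  rcases (norm_nonneg (α.unitTmul a b)).eq_or_lt with h0 | h0
  · rw [← h0]; positivity
  · exact le_of_mul_le_mul_right h h0

theorem norm_incl_tmul_le {p : G × H} (a : A.fiber p.1) (b : B.fiber p.2) :
    ‖α.incl p (a ⊗ₜ[ℂ] b)‖ ≤ ‖a‖ * ‖b‖ := by
  refine (pow_le_pow_iff_left₀ (norm_nonneg _) (by positivity) two_ne_zero).1 ?_
  rw [← α.tensor.norm_inner_self, tensor_inner_incl, algTensor_inner_tmul, mul_pow,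
    ← A.norm_inner_self, ← B.norm_inner_self]
  exact α.norm_unitTmul_le_of_nonneg (A.inner_nonneg a) (B.inner_nonneg b)

/-- `a ⊗ b` as a continuous bilinear map of the unit fibers. -/
noncomputable def unitTmulL : A.fiber 1 →L[ℂ] B.fiber 1 →L[ℂ] α.tensor.fiber 1 :=
  α.unitTmul.mkContinuous₂ 1 fun a b => by
    rw [one_mul]; exact α.norm_incl_tmul_le (p := 1) a b

theorem summable_unitTmul {f : G → A.fiber 1} {g : H → B.fiber 1} (hf0 : ∀ t, 0 ≤ f t)
    (hg0 : ∀ s, 0 ≤ g s) (hf : Summable f) (hg : Summable g) :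
    Summable fun p : G × H => α.unitTmul (f p.1) (g p.2) := by
  classical
  have bf : ∀ s : Finset G, ‖∑ i ∈ s, f i‖ ≤ ‖∑' i, f i‖ := fun s =>
    CStarAlgebra.norm_le_norm_of_nonneg_of_le (Finset.sum_nonneg fun i _ => hf0 i)
      (hf.sum_le_tsum s fun i _ => hf0 i)
  have bg : ∀ s : Finset H, ‖∑ i ∈ s, g i‖ ≤ ‖∑' i, g i‖ := fun s =>
    CStarAlgebra.norm_le_norm_of_nonneg_of_le (Finset.sum_nonneg fun i _ => hg0 i)
      (hg.sum_le_tsum s fun i _ => hg0 i)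
  have hprod : ∀ (s : Finset G) (s' : Finset H),
      ∑ p ∈ s ×ˢ s', α.unitTmul (f p.1) (g p.2) = α.unitTmul (∑ i ∈ s, f i) (∑ j ∈ s', g j) := by
    intro s s'
    rw [Finset.sum_product, map_sum α.unitTmul, LinearMap.sum_apply]
    exact Finset.sum_congr rfl fun i _ => (map_sum (α.unitTmul (f i)) _ _).symm
  have hbound : ∀ (s : Finset G) (s' : Finset H),
      ‖∑ p ∈ s ×ˢ s', α.unitTmul (f p.1) (g p.2)‖ ≤ ‖∑ i ∈ s, f i‖ * ‖∑ j ∈ s', g j‖ :=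
    fun s s' => by rw [hprod]; exact α.norm_incl_tmul_le (p := 1) _ _
  have h0 : ∀ p : G × H, 0 ≤ α.unitTmul (f p.1) (g p.2) := fun p =>
    α.unitTmul_nonneg (hf0 _) (hg0 _)
  rw [summable_iff_vanishing_norm]
  intro ε hε
  set M := ‖∑' i, f i‖ + ‖∑' i, g i‖ + 1 with hM
  have hMpos : 0 < M := by positivity
  obtain ⟨K, hK⟩ := summable_iff_vanishing_norm.1 hf (ε / M) (by positivity)
  obtain ⟨L, hL⟩ := summable_iff_vanishing_norm.1 hg (ε / M) (by positivity)
  refine ⟨K ×ˢ L, fun t ht => ?_⟩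
  set S := t.image Prod.fst
  set S' := t.image Prod.snd
  have hsub : t ⊆ (S \ K) ×ˢ S' ∪ S ×ˢ (S' \ L) := by
    intro p hp
    have h1 : p.1 ∈ S := Finset.mem_image_of_mem _ hp
    have h2 : p.2 ∈ S' := Finset.mem_image_of_mem _ hp
    have h3 : p ∉ K ×ˢ L := Finset.disjoint_left.1 ht hp
    rw [Finset.mem_product, not_and_or] at h3
    simp only [Finset.mem_union, Finset.mem_product, Finset.mem_sdiff]
    tauto
  have hle : ∑ p ∈ t, α.unitTmul (f p.1) (g p.2)
      ≤ ∑ p ∈ (S \ K) ×ˢ S', α.unitTmul (f p.1) (g p.2)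
        + ∑ p ∈ S ×ˢ (S' \ L), α.unitTmul (f p.1) (g p.2) := by
    refine (Finset.sum_le_sum_of_subset_of_nonneg hsub fun p _ _ => h0 p).trans ?_
    rw [← Finset.sum_union_inter]
    exact le_add_of_nonneg_right (Finset.sum_nonneg fun p _ => h0 p)
  have h1 := hK (S \ K) Finset.sdiff_disjoint
  have h2 := hL (S' \ L) Finset.sdiff_disjoint
  have h3 := (hbound (S \ K) S').trans (mul_le_mul h1.le (bg S') (norm_nonneg _) (by positivity))
  have h4 := (hbound S (S' \ L)).trans (mul_le_mul (bf S) h2.le (norm_nonneg _) (by positivity))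
  calc _ ≤ _ := CStarAlgebra.norm_le_norm_of_nonneg_of_le (Finset.sum_nonneg fun p _ => h0 p) hle
    _ ≤ _ := _root_.norm_add_le _ _
    _ ≤ ε / M * ‖∑' i, g i‖ + ‖∑' i, f i‖ * (ε / M) := add_le_add h3 h4
    _ = ε / M * (M - 1) := by rw [hM]; ring
    _ < ε / M * M := by gcongr; linarith
    _ = ε := div_mul_cancel₀ ε hMpos.ne'

/-- The section `(t, s) ↦ ξ(t) ⊗ η(s)`. -/
noncomputable def sectionTmul (ξ : A.ell2) (η : B.ell2) : α.tensor.ell2 :=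
  HilbertSum.mk (fun p => α.incl p (ξ p.1 ⊗ₜ[ℂ] η p.2)) <| by
    refine (α.summable_unitTmul (fun t => A.inner_nonneg (ξ t)) (fun s => B.inner_nonneg (η s))
      ξ.summable_self η.summable_self).congr fun p => ?_
    exact (α.tensor_inner_incl (p := p) (ξ p.1 ⊗ₜ[ℂ] η p.2) (ξ p.1 ⊗ₜ[ℂ] η p.2)).symm

theorem inner_sectionTmul (ξ ξ' : A.ell2) (η η' : B.ell2) :
    HilbertModule.inner (α.tensor.fiber 1) (α.sectionTmul ξ η) (α.sectionTmul ξ' η')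
      = α.unitTmul (HilbertModule.inner (A.fiber 1) ξ ξ') (HilbertModule.inner (B.fiber 1) η η') := by
  have h := HilbertSum.hasSum_inner (α.sectionTmul ξ η) (α.sectionTmul ξ' η')
  have h1 : ∀ t : G, HasSum (fun s : H => HilbertModule.inner (α.tensor.fiber 1)
      (α.sectionTmul ξ η (t, s)) (α.sectionTmul ξ' η' (t, s)))
      (α.unitTmulL (A.inner t (ξ t) (ξ' t)) (HilbertModule.inner (B.fiber 1) η η')) := fun t =>
    (((HilbertSum.hasSum_inner η η').mapL (α.unitTmulL (A.inner t (ξ t) (ξ' t)))).congr_fun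
      fun s => α.tensor_inner_incl (p := (t, s)) (ξ t ⊗ₜ[ℂ] η s) (ξ' t ⊗ₜ[ℂ] η' s))
  exact (h.prod_fiberwise h1).unique
    ((HilbertSum.hasSum_inner ξ ξ').mapL
      (α.unitTmulL.flip (HilbertModule.inner (B.fiber 1) η η')))

end CStarNorm

end FellTensor

section Ell2Tensor

open UniformSpace

variable {G : Type u} [Group G] {H : Type u'} [Group H] {A : FellBundle.{u, v} G}
  {B : FellBundle.{u', v'} H}

namespace CStarNorm

variable (α : CStarNorm (A.toStarBundle.algTensor B.toStarBundle))

/-- The inner product `⟪ξ ⊙ η, ξ' ⊙ η'⟫ = ⟪ξ, ξ'⟫ ⊗ ⟪η, η'⟫` on `ℓ²(A) ⊙ ℓ²(B)`, with values in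
the unit fiber of `A ⊗_α B`. -/
noncomputable def ellForm : A.ell2 ⊗[ℂ] B.ell2 →ₗ⋆[ℂ] A.ell2 ⊗[ℂ] B.ell2 →ₗ[ℂ] α.tensor.fiber 1 :=
  (TensorProduct.map₂ (HilbertModule.inner (A.fiber 1) (E := A.ell2))
    (HilbertModule.inner (B.fiber 1) (E := B.ell2))).compr₂ₛₗ (α.incl 1)

theorem ellForm_tmul (ξ ξ' : A.ell2) (η η' : B.ell2) :
    α.ellForm (ξ ⊗ₜ η) (ξ' ⊗ₜ η') = α.unitTmul (HilbertModule.inner (A.fiber 1) ξ ξ')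
      (HilbertModule.inner (B.fiber 1) η η') := rfl

/-- The action `(ξ ⊙ η) (a ⊙ b) = ξ a ⊙ η b` of `A_1 ⊙ B_1` on `ℓ²(A) ⊙ ℓ²(B)`. -/
noncomputable def ellAct : A.ell2 ⊗[ℂ] B.ell2 →ₗ[ℂ] A.fiber 1 ⊗[ℂ] B.fiber 1 →ₗ[ℂ]
    A.ell2 ⊗[ℂ] B.ell2 :=
  TensorProduct.map₂ (HilbertModule.act (B := A.fiber 1) (E := A.ell2))
    (HilbertModule.act (B := B.fiber 1) (E := B.ell2))

theorem star_ellForm (x y : A.ell2 ⊗[ℂ] B.ell2) : star (α.ellForm x y) = α.ellForm y x := by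
  induction x using TensorProduct.induction_on with
  | zero => simp only [map_zero, LinearMap.zero_apply, star_zero]
  | add x x' hx hx' => simp only [map_add, LinearMap.add_apply, star_add, hx, hx']
  | tmul ξ η =>
    induction y using TensorProduct.induction_on with
    | zero => simp only [map_zero, LinearMap.zero_apply, star_zero]
    | add x x' hx hx' => simp only [map_add, LinearMap.add_apply, star_add, hx, hx']
    | tmul ξ' η' =>
      rw [ellForm_tmul, ellForm_tmul, star_unitTmul, HilbertModule.star_inner,
        HilbertModule.star_inner]

theorem ellForm_act (x y : A.ell2 ⊗[ℂ] B.ell2) (c : A.fiber 1 ⊗[ℂ] B.fiber 1) :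
    α.ellForm x (ellAct y c) = α.ellForm x y * α.incl 1 c := by
  induction c using TensorProduct.induction_on with
  | zero => simp only [map_zero, mul_zero]
  | add c c' hc hc' => 
    rw [map_add, map_add, hc, hc', map_add (α.incl 1), mul_add]
  | tmul a b =>
    induction x using TensorProduct.induction_on with
    | zero => simp only [map_zero, LinearMap.zero_apply, zero_mul]
    | add x x' hx hx' => simp only [map_add, LinearMap.add_apply, add_mul, hx, hx']
    | tmul ξ η =>
      induction y using TensorProduct.induction_on with
      | zero => simp only [map_zero, LinearMap.zero_apply, zero_mul]
      | add x x' hx hx' => simp only [map_add, LinearMap.add_apply, add_mul, hx, hx']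
      | tmul ξ' η' =>
        have h : ellAct (ξ' ⊗ₜ[ℂ] η') (a ⊗ₜ[ℂ] b)
          = HilbertModule.act ξ' a ⊗ₜ[ℂ] HilbertModule.act η' b := rfl
        rw [h, ellForm_tmul, ellForm_tmul, HilbertModule.inner_act, HilbertModule.inner_act,
          ← unitTmul_mul]
        rfl

/-- The linear map `ξ ⊙ η ↦ ((t, s) ↦ ξ(t) ⊗ η(s))`. -/
noncomputable def sectionMap : A.ell2 ⊗[ℂ] B.ell2 →ₗ[ℂ] α.tensor.ell2 :=
  TensorProduct.lift <| LinearMap.mk₂ ℂ α.sectionTmul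
    (fun ξ ξ' η => HilbertSum.ext fun p => by
      change α.incl p ((ξ p.1 + ξ' p.1) ⊗ₜ[ℂ] η p.2)
        = α.incl p (ξ p.1 ⊗ₜ[ℂ] η p.2) + α.incl p (ξ' p.1 ⊗ₜ[ℂ] η p.2)
      rw [TensorProduct.add_tmul, map_add])
    (fun z ξ η => HilbertSum.ext fun p => by
      change α.incl p ((z • ξ p.1) ⊗ₜ[ℂ] η p.2) = z • α.incl p (ξ p.1 ⊗ₜ[ℂ] η p.2)
      exact (congrArg (α.incl p) (TensorProduct.smul_tmul' z _ _)).symm.trans (map_smul _ _ _))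
    (fun ξ η η' => HilbertSum.ext fun p => by
      change α.incl p (ξ p.1 ⊗ₜ[ℂ] (η p.2 + η' p.2))
        = α.incl p (ξ p.1 ⊗ₜ[ℂ] η p.2) + α.incl p (ξ p.1 ⊗ₜ[ℂ] η' p.2)
      rw [TensorProduct.tmul_add, map_add])
    (fun z ξ η => HilbertSum.ext fun p => by
      change α.incl p (ξ p.1 ⊗ₜ[ℂ] (z • η p.2)) = z • α.incl p (ξ p.1 ⊗ₜ[ℂ] η p.2)
      rw [TensorProduct.tmul_smul, map_smul])

theorem inner_sectionMap (x y : A.ell2 ⊗[ℂ] B.ell2) :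
    HilbertModule.inner (α.tensor.fiber 1) (α.sectionMap x) (α.sectionMap y) = α.ellForm x y := by
  induction x using TensorProduct.induction_on with
  | zero => simp only [map_zero, LinearMap.zero_apply]
  | add x x' hx hx' => simp only [map_add, LinearMap.add_apply, hx, hx']
  | tmul ξ η =>
    induction y using TensorProduct.induction_on with
    | zero => simp only [map_zero, LinearMap.zero_apply]
    | add x x' hx hx' => simp only [map_add, hx, hx']
    | tmul ξ' η' => exact α.inner_sectionTmul ξ ξ' η η'

theorem ellForm_nonneg (x : A.ell2 ⊗[ℂ] B.ell2) : 0 ≤ α.ellForm x x := by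
  rw [← inner_sectionMap]; exact HilbertModule.inner_nonneg _ _

/-- `ℓ²(A) ⊙ ℓ²(B)` with the (semi)norm `x ↦ α(⟪x, x⟫) ^ (1/2)`. -/
def Ell2AlgTensor (_ : CStarNorm (A.toStarBundle.algTensor B.toStarBundle)) : Type _ :=
  A.ell2 ⊗[ℂ] B.ell2

noncomputable instance : AddCommGroup (Ell2AlgTensor α) :=
  inferInstanceAs (AddCommGroup (A.ell2 ⊗[ℂ] B.ell2))

noncomputable instance : Module ℂ (Ell2AlgTensor α) :=
  inferInstanceAs (Module ℂ (A.ell2 ⊗[ℂ] B.ell2))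

/-- The identity map. -/
noncomputable def toEll2Alg : A.ell2 ⊗[ℂ] B.ell2 ≃ₗ[ℂ] Ell2AlgTensor α := LinearEquiv.refl ℂ _

/-- The inner product of `ℓ²(A) ⊙ ℓ²(B)`. -/
noncomputable def algForm : Ell2AlgTensor α →ₗ⋆[ℂ] Ell2AlgTensor α →ₗ[ℂ] α.tensor.fiber 1 :=
  α.ellForm

noncomputable instance : SeminormedAddCommGroup (Ell2AlgTensor α) :=
  AddGroupSeminorm.toSeminormedAddCommGroup
    { toFun := fun x => √‖α.algForm x x‖
      map_zero' := by simp
      add_le' := preInner_triangle α.algForm α.star_ellForm α.ellForm_nonneg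
        fun x y => ⟨ellAct x (TensorProduct.map₂ (HilbertModule.inner (A.fiber 1) (E := A.ell2))
          (HilbertModule.inner (B.fiber 1) (E := B.ell2)) x y), fun w => α.ellForm_act w x _⟩
      neg' := fun a => by simp }

theorem norm_sq_alg (x : Ell2AlgTensor α) : ‖x‖ ^ 2 = ‖α.algForm x x‖ :=
  Real.sq_sqrt (norm_nonneg _)

noncomputable instance : NormedSpace ℂ (Ell2AlgTensor α) where
  norm_smul_le z x := (preInner_sqrt_smul α.algForm z x).le

theorem norm_algForm_le (x y : Ell2AlgTensor α) : ‖α.algForm x y‖ ≤ 1 * ‖x‖ * ‖y‖ := by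
  have h := preInner_cauchySchwarz α.algForm α.star_ellForm α.ellForm_nonneg
    (fun x y => ⟨ellAct x (TensorProduct.map₂ (HilbertModule.inner (A.fiber 1) (E := A.ell2))
          (HilbertModule.inner (B.fiber 1) (E := B.ell2)) x y), fun w => α.ellForm_act w x _⟩) x y
  rw [← norm_sq_alg, ← norm_sq_alg, ← mul_pow] at h
  rw [one_mul]
  exact (pow_le_pow_iff_left₀ (norm_nonneg _) (by positivity) two_ne_zero).1 h

/-- The inclusion of `A_1 ⊙ B_1` in the unit fiber of `A ⊗_α B`. -/
noncomputable def unitIncl : α.preTensor.fiber 1 →ₗᵢ[ℂ] α.tensor.fiber 1 :=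
  α.preTensor.toCompletion 1

theorem denseRange_unitIncl : DenseRange α.unitIncl := α.preTensor.denseRange_toCompletion 1

/-- The action of `A_1 ⊙ B_1` on `ℓ²(A) ⊙ ℓ²(B)`. -/
noncomputable def algAct : Ell2AlgTensor α →ₗ[ℂ] α.preTensor.fiber 1 →ₗ[ℂ] Ell2AlgTensor α :=
  ellAct

theorem algForm_act (x y : Ell2AlgTensor α) (c : α.preTensor.fiber 1) :
    α.algForm x (α.algAct y c) = α.algForm x y * α.unitIncl c :=
  α.ellForm_act x y c

theorem norm_algAct_le (x : Ell2AlgTensor α) (c : α.preTensor.fiber 1) :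
    ‖α.algAct x c‖ ≤ 1 * ‖x‖ * ‖c‖ := by
  refine (pow_le_pow_iff_left₀ (norm_nonneg _) (by positivity) two_ne_zero).1 ?_
  rw [norm_sq_alg, algForm_act]
  have h : α.algForm (α.algAct x c) x = star (α.unitIncl c) * α.algForm x x := by
    have h1 : star (α.algForm x (α.algAct x c)) = α.algForm (α.algAct x c) x :=
      α.star_ellForm _ _
    have h2 : star (α.algForm x x) = α.algForm x x := α.star_ellForm _ _
    rw [← h1, algForm_act, star_mul, h2]
  have h3 : ‖α.unitIncl c‖ = ‖c‖ := (α.unitIncl).norm_map c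
  rw [h]
  calc _ ≤ ‖star (α.unitIncl c)‖ * ‖α.algForm x x‖
        * ‖α.unitIncl c‖ :=
      (_root_.norm_mul_le _ _).trans (mul_le_mul_of_nonneg_right (_root_.norm_mul_le _ _)
        (norm_nonneg _))
    _ = _ := by rw [_root_.norm_star, ← norm_sq_alg, h3]; ring

/-- The Hilbert module `ℓ²(A) ⊗_α ℓ²(B)` over the unit fiber of `A ⊗_α B`: the completion of
`ℓ²(A) ⊙ ℓ²(B)`, with the continuous extensions of the inner product and the action. -/
def Ell2Tensor : Type _ := Completion (Ell2AlgTensor α)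

namespace Ell2Tensor

noncomputable instance : NormedAddCommGroup (Ell2Tensor α) :=
  inferInstanceAs (NormedAddCommGroup (Completion (Ell2AlgTensor α)))

noncomputable instance : NormedSpace ℂ (Ell2Tensor α) :=
  inferInstanceAs (NormedSpace ℂ (Completion (Ell2AlgTensor α)))

instance : CompleteSpace (Ell2Tensor α) :=
  inferInstanceAs (CompleteSpace (Completion (Ell2AlgTensor α)))

/-- The inclusion of `ℓ²(A) ⊙ ℓ²(B)`. -/
noncomputable def of : Ell2AlgTensor α →ₗᵢ[ℂ] Ell2Tensor α :=
  Completion.toComplₗᵢ (𝕜 := ℂ) (E := Ell2AlgTensor α)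

theorem denseRange_of : DenseRange (of α) := Completion.denseRange_coe

/-- The inner product of `ℓ²(A) ⊗_α ℓ²(B)`. -/
noncomputable def formL : Ell2Tensor α →L⋆[ℂ] Ell2Tensor α →L[ℂ] α.tensor.fiber 1 :=
  extendBilin (of α) (of α) α.algForm 1 α.norm_algForm_le

theorem formL_of (x y : Ell2AlgTensor α) : formL α (of α x) (of α y) = α.algForm x y :=
  extendBilin_apply (denseRange_of α) (denseRange_of α) _ _ _ x y

/-- The action on `ℓ²(A) ⊗_α ℓ²(B)`. -/
noncomputable def actL : Ell2Tensor α →L[ℂ] α.tensor.fiber 1 →L[ℂ] Ell2Tensor α :=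
  extendBilin (of α) (α.unitIncl) (α.algAct.compr₂ (of α).toLinearMap) 1
    fun x c => by
      have h := (of α).norm_map (α.algAct x c)
      exact h.le.trans (α.norm_algAct_le x c)

theorem actL_of (x : Ell2AlgTensor α) (c : α.preTensor.fiber 1) :
    actL α (of α x) (α.unitIncl c) = of α (α.algAct x c) :=
  extendBilin_apply (denseRange_of α) α.denseRange_unitIncl _ _ _ x c

noncomputable instance : HilbertModule (α.tensor.fiber 1) (Ell2Tensor α) where
  form := LinearMap.mk₂'ₛₗ (starRingEnd ℂ) (RingHom.id ℂ) (fun x y => formL α x y)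
    (by simp) (by simp) (by simp) (by simp)
  act := LinearMap.mk₂ ℂ (fun x c => actL α x c) (by simp) (by simp) (by simp) (by simp)
  star_form x y := by
    change star (formL α x y) = formL α y x
    refine (denseRange_of α).induction_on₂ (p := fun x y => star (formL α x y) = formL α y x)
      (isClosed_eq (by fun_prop) (by fun_prop)) (fun x y => ?_) x y
    rw [formL_of, formL_of]
    exact α.star_ellForm x y
  form_nonneg x := by
    change 0 ≤ formL α x x
    refine (denseRange_of α).induction_on (p := fun x => 0 ≤ formL α x x) x
      (CStarAlgebra.isClosed_nonneg.preimage
        (show Continuous fun x => formL α x x by fun_prop)) fun x => ?_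
    rw [formL_of]
    exact α.ellForm_nonneg x
  form_act x y b := by
    change formL α x (actL α y b) = formL α x y * b
    refine (denseRange_of α).induction_on₂ (p := fun x y => formL α x (actL α y b)
      = formL α x y * b) (isClosed_eq (by fun_prop) (by fun_prop)) (fun x y => ?_) x y
    refine α.denseRange_unitIncl.induction_on (p := fun b =>
      formL α (of α x) (actL α (of α y) b) = formL α (of α x) (of α y) * b) b
      (isClosed_eq (by fun_prop) (by fun_prop)) fun c => ?_
    rw [actL_of, formL_of, formL_of, algForm_act]
  norm_sq_form x := by
    change ‖x‖ ^ 2 = ‖formL α x x‖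
    refine (denseRange_of α).induction_on (p := fun x => ‖x‖ ^ 2 = ‖formL α x x‖) x
      (isClosed_eq (by fun_prop) (by fun_prop)) fun x => ?_
    rw [formL_of, (of α).norm_map, norm_sq_alg]

theorem inner_of (x y : A.ell2 ⊗[ℂ] B.ell2) : HilbertModule.inner (α.tensor.fiber 1)
    (of α (α.toEll2Alg x)) (of α (α.toEll2Alg y)) = α.ellForm x y := formL_of α _ _

theorem norm_of_sq (x : A.ell2 ⊗[ℂ] B.ell2) : ‖of α (α.toEll2Alg x)‖ ^ 2 = ‖α.ellForm x x‖ := by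
  rw [HilbertModule.norm_sq (α.tensor.fiber 1), inner_of]

/-- The element `ξ ⊗ η` of `ℓ²(A) ⊗_α ℓ²(B)`. -/
noncomputable def tmul (ξ : A.ell2) (η : B.ell2) : Ell2Tensor α :=
  of α (α.toEll2Alg (ξ ⊗ₜ[ℂ] η))

end Ell2Tensor

end CStarNorm

end Ell2Tensor

section OpTensor

open UniformSpace

variable {G : Type u} [Group G] {H : Type u'} [Group H] {A : FellBundle.{u, v} G}
  {B : FellBundle.{u', v'} H}

namespace CStarNorm

variable (α : CStarNorm (A.toStarBundle.algTensor B.toStarBundle))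

/-- The operator `ξ ⊙ η ↦ S ξ ⊙ T η` on `ℓ²(A) ⊙ ℓ²(B)`. -/
noncomputable def algOp (S : Adjointable (A.fiber 1) A.ell2) (T : Adjointable (B.fiber 1) B.ell2) :
    A.ell2 ⊗[ℂ] B.ell2 →ₗ[ℂ] A.ell2 ⊗[ℂ] B.ell2 :=
  TensorProduct.map S.1.toLinearMap T.1.toLinearMap

theorem ellForm_algOp (S : Adjointable (A.fiber 1) A.ell2) (T : Adjointable (B.fiber 1) B.ell2)
    (x y : A.ell2 ⊗[ℂ] B.ell2) :
    α.ellForm (algOp S T x) y = α.ellForm x (algOp (star S) (star T) y) := by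
  induction x using TensorProduct.induction_on with
  | zero => simp only [map_zero, LinearMap.zero_apply]
  | add x x' hx hx' => simp only [map_add, LinearMap.add_apply, hx, hx']
  | tmul ξ η =>
    induction y using TensorProduct.induction_on with
    | zero => simp only [map_zero]
    | add x x' hx hx' => simp only [map_add, hx, hx']
    | tmul ξ' η' =>
      change α.unitTmul (HilbertModule.inner (A.fiber 1) (S.1 ξ) ξ')
          (HilbertModule.inner (B.fiber 1) (T.1 η) η')
        = α.unitTmul (HilbertModule.inner (A.fiber 1) ξ ((star S).1 ξ'))
          (HilbertModule.inner (B.fiber 1) η ((star T).1 η'))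
      rw [Adjointable.inner_star_right, Adjointable.inner_star_right]

theorem exists_algOp_left (S : Adjointable (A.fiber 1) A.ell2) :
    ∃ R : Adjointable (A.fiber 1) A.ell2, ∀ x y : A.ell2 ⊗[ℂ] B.ell2,
      α.ellForm (algOp S 1 x) (algOp S 1 y) + α.ellForm (algOp R 1 x) (algOp R 1 y)
        = ((‖S‖ ^ 2 : ℝ) : ℂ) • α.ellForm x y := by
  obtain ⟨R, hR⟩ := S.exists_sub_star_mul
  refine ⟨R, fun x y => ?_⟩
  induction x using TensorProduct.induction_on with
  | zero => simp only [map_zero, LinearMap.zero_apply, smul_zero, add_zero]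
  | add x x' hx hx' =>
    simp only [map_add, LinearMap.add_apply, smul_add, ← hx, ← hx']; abel
  | tmul ξ η =>
    induction y using TensorProduct.induction_on with
    | zero => simp only [map_zero, smul_zero, add_zero]
    | add x x' hx hx' => simp only [map_add, smul_add, ← hx, ← hx']; abel
    | tmul ξ' η' =>
      change α.unitTmul (HilbertModule.inner (A.fiber 1) (S.1 ξ) (S.1 ξ'))
          (HilbertModule.inner (B.fiber 1) η η')
        + α.unitTmul (HilbertModule.inner (A.fiber 1) (R.1 ξ) (R.1 ξ'))
          (HilbertModule.inner (B.fiber 1) η η')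
        = _ • α.unitTmul (HilbertModule.inner (A.fiber 1) ξ ξ')
          (HilbertModule.inner (B.fiber 1) η η')
      rw [← LinearMap.add_apply, ← map_add, hR, map_smul, LinearMap.smul_apply]

theorem exists_algOp_right (T : Adjointable (B.fiber 1) B.ell2) :
    ∃ R : Adjointable (B.fiber 1) B.ell2, ∀ x y : A.ell2 ⊗[ℂ] B.ell2,
      α.ellForm (algOp 1 T x) (algOp 1 T y) + α.ellForm (algOp 1 R x) (algOp 1 R y)
        = ((‖T‖ ^ 2 : ℝ) : ℂ) • α.ellForm x y := by
  obtain ⟨R, hR⟩ := T.exists_sub_star_mul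
  refine ⟨R, fun x y => ?_⟩
  induction x using TensorProduct.induction_on with
  | zero => simp only [map_zero, LinearMap.zero_apply, smul_zero, add_zero]
  | add x x' hx hx' =>
    simp only [map_add, LinearMap.add_apply, smul_add, ← hx, ← hx']; abel
  | tmul ξ η =>
    induction y using TensorProduct.induction_on with
    | zero => simp only [map_zero, smul_zero, add_zero]
    | add x x' hx hx' => simp only [map_add, smul_add, ← hx, ← hx']; abel
    | tmul ξ' η' =>
      change α.unitTmul (HilbertModule.inner (A.fiber 1) ξ ξ')
          (HilbertModule.inner (B.fiber 1) (T.1 η) (T.1 η'))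
        + α.unitTmul (HilbertModule.inner (A.fiber 1) ξ ξ')
          (HilbertModule.inner (B.fiber 1) (R.1 η) (R.1 η'))
        = _ • α.unitTmul (HilbertModule.inner (A.fiber 1) ξ ξ')
          (HilbertModule.inner (B.fiber 1) η η')
      rw [← map_add, hR, map_smul]

theorem norm_ellForm_le {x y z : A.ell2 ⊗[ℂ] B.ell2} {c : ℝ}
    (h : α.ellForm y y + α.ellForm z z = ((c ^ 2 : ℝ) : ℂ) • α.ellForm x x) :
    ‖α.ellForm y y‖ ≤ c ^ 2 * ‖α.ellForm x x‖ := by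
  have h1 : α.ellForm y y ≤ ((c ^ 2 : ℝ) : ℂ) • α.ellForm x x := by
    rw [← h]; exact le_add_of_nonneg_right (α.ellForm_nonneg z)
  refine (CStarAlgebra.norm_le_norm_of_nonneg_of_le (α.ellForm_nonneg y) h1).trans ?_
  rw [_root_.norm_smul, Complex.norm_real, Real.norm_of_nonneg (sq_nonneg c)]

theorem norm_algOp_le (S : Adjointable (A.fiber 1) A.ell2) (T : Adjointable (B.fiber 1) B.ell2)
    (x : A.ell2 ⊗[ℂ] B.ell2) :
    ‖Ell2Tensor.of α (α.toEll2Alg (algOp S T x))‖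
      ≤ ‖S‖ * ‖T‖ * ‖Ell2Tensor.of α (α.toEll2Alg x)‖ := by
  refine (pow_le_pow_iff_left₀ (norm_nonneg _) (by positivity) two_ne_zero).1 ?_
  rw [mul_pow, mul_pow, Ell2Tensor.norm_of_sq, Ell2Tensor.norm_of_sq, mul_assoc]
  have e : algOp S T x = algOp S 1 (algOp 1 T x) := by
    rw [← LinearMap.comp_apply, algOp, algOp, algOp, ← TensorProduct.map_comp]
    rfl
  obtain ⟨R, hR⟩ := α.exists_algOp_left S
  obtain ⟨R', hR'⟩ := α.exists_algOp_right T
  rw [e]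
  exact (α.norm_ellForm_le (hR _ _)).trans (mul_le_mul_of_nonneg_left
    (α.norm_ellForm_le (hR' x x)) (sq_nonneg _))

/-- The continuous extension of `ξ ⊙ η ↦ S ξ ⊙ T η`. -/
noncomputable def opCLM (S : Adjointable (A.fiber 1) A.ell2)
    (T : Adjointable (B.fiber 1) B.ell2) : Ell2Tensor α →L[ℂ] Ell2Tensor α :=
  (LinearMap.mkContinuous ((Ell2Tensor.of α).toLinearMap ∘ₗ α.toEll2Alg.toLinearMap ∘ₗ algOp S T ∘ₗ
    α.toEll2Alg.symm.toLinearMap) (‖S‖ * ‖T‖) (fun x => (α.norm_algOp_le S T x).trans_eq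
      (congrArg _ ((Ell2Tensor.of α).norm_map _)))).extend (Ell2Tensor.of α).toContinuousLinearMap

theorem opCLM_of (S : Adjointable (A.fiber 1) A.ell2) (T : Adjointable (B.fiber 1) B.ell2)
    (x : A.ell2 ⊗[ℂ] B.ell2) : α.opCLM S T (Ell2Tensor.of α (α.toEll2Alg x))
      = Ell2Tensor.of α (α.toEll2Alg (algOp S T x)) :=
  ContinuousLinearMap.extend_eq _ (e := (Ell2Tensor.of α).toContinuousLinearMap)
    (Ell2Tensor.denseRange_of α) (Ell2Tensor.of α).isometry.isUniformInducing (α.toEll2Alg x)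

theorem inner_opCLM (S : Adjointable (A.fiber 1) A.ell2) (T : Adjointable (B.fiber 1) B.ell2)
    (x y : Ell2Tensor α) : HilbertModule.inner (α.tensor.fiber 1) (α.opCLM S T x) y
      = HilbertModule.inner (α.tensor.fiber 1) x (α.opCLM (star S) (star T) y) := by
  simp only [← HilbertModule.innerSL_apply]
  refine (Ell2Tensor.denseRange_of α).induction_on₂ (p := fun x y =>
    HilbertModule.innerSL (α.tensor.fiber 1) (α.opCLM S T x) y
      = HilbertModule.innerSL (α.tensor.fiber 1) x (α.opCLM (star S) (star T) y))
    (isClosed_eq (by fun_prop) (by fun_prop)) (fun x y => ?_) x y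
  obtain ⟨x, rfl⟩ := α.toEll2Alg.surjective x
  obtain ⟨y, rfl⟩ := α.toEll2Alg.surjective y
  rw [opCLM_of, opCLM_of, HilbertModule.innerSL_apply, HilbertModule.innerSL_apply,
    Ell2Tensor.inner_of, Ell2Tensor.inner_of, ellForm_algOp]

/-- The operator `S ⊗ T` on `ℓ²(A) ⊗_α ℓ²(B)`, `(S ⊗ T) (ξ ⊗ η) = S ξ ⊗ T η`. -/
noncomputable def opTensor (S : Adjointable (A.fiber 1) A.ell2)
    (T : Adjointable (B.fiber 1) B.ell2) : Adjointable (α.tensor.fiber 1) (Ell2Tensor α) :=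
  Adjointable.mk (α.opCLM S T) (α.opCLM (star S) (star T)) (α.inner_opCLM S T)

theorem opTensor_tmul (S : Adjointable (A.fiber 1) A.ell2) (T : Adjointable (B.fiber 1) B.ell2)
    (ξ : A.ell2) (η : B.ell2) : (α.opTensor S T).1 (Ell2Tensor.tmul α ξ η)
      = Ell2Tensor.tmul α (S.1 ξ) (T.1 η) := α.opCLM_of S T (ξ ⊗ₜ η)

theorem adjointable_ext {P Q : Adjointable (α.tensor.fiber 1) (Ell2Tensor α)}
    (h : ∀ ξ η, P.1 (Ell2Tensor.tmul α ξ η) = Q.1 (Ell2Tensor.tmul α ξ η)) : P = Q := by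
  refine Adjointable.ext fun x => ?_
  refine (Ell2Tensor.denseRange_of α).induction_on (p := fun x => P.1 x = Q.1 x) x
    (isClosed_eq (by fun_prop) (by fun_prop)) fun x => ?_
  obtain ⟨x, rfl⟩ := α.toEll2Alg.surjective x
  induction x using TensorProduct.induction_on with
  | zero => simp only [map_zero]
  | add x y hx hy => simp only [map_add, hx, hy]
  | tmul ξ η => exact h ξ η

theorem tmul_add_left (ξ ξ' : A.ell2) (η : B.ell2) : Ell2Tensor.tmul α (ξ + ξ') η
    = Ell2Tensor.tmul α ξ η + Ell2Tensor.tmul α ξ' η := by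
  simp only [Ell2Tensor.tmul, TensorProduct.add_tmul, map_add]

theorem tmul_add_right (ξ : A.ell2) (η η' : B.ell2) : Ell2Tensor.tmul α ξ (η + η')
    = Ell2Tensor.tmul α ξ η + Ell2Tensor.tmul α ξ η' := by
  simp only [Ell2Tensor.tmul, TensorProduct.tmul_add, map_add]

theorem tmul_smul_left (z : ℂ) (ξ : A.ell2) (η : B.ell2) : Ell2Tensor.tmul α (z • ξ) η
    = z • Ell2Tensor.tmul α ξ η := by
  simp only [Ell2Tensor.tmul, ← TensorProduct.smul_tmul', map_smul]

theorem tmul_smul_right (z : ℂ) (ξ : A.ell2) (η : B.ell2) : Ell2Tensor.tmul α ξ (z • η)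
    = z • Ell2Tensor.tmul α ξ η := by
  simp only [Ell2Tensor.tmul, TensorProduct.tmul_smul, map_smul]

/-- The linear map `S ⊙ T ↦ S ⊗ T` from `𝓛(ℓ²(A)) ⊙ 𝓛(ℓ²(B))` to `𝓛(ℓ²(A) ⊗_α ℓ²(B))`. -/
noncomputable def opMap : Adjointable (A.fiber 1) A.ell2 ⊗[ℂ] Adjointable (B.fiber 1) B.ell2 →ₗ[ℂ]
    Adjointable (α.tensor.fiber 1) (Ell2Tensor α) :=
  TensorProduct.lift <| LinearMap.mk₂ ℂ α.opTensor
    (fun S S' T => α.adjointable_ext fun ξ η => by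
      simp only [opTensor_tmul, Adjointable.add_apply, tmul_add_left])
    (fun z S T => α.adjointable_ext fun ξ η => by
      simp only [opTensor_tmul, Adjointable.smul_apply, tmul_smul_left])
    (fun S T T' => α.adjointable_ext fun ξ η => by
      simp only [opTensor_tmul, Adjointable.add_apply, tmul_add_right])
    (fun z S T => α.adjointable_ext fun ξ η => by
      simp only [opTensor_tmul, Adjointable.smul_apply, tmul_smul_right])

theorem opMap_tmul (S : Adjointable (A.fiber 1) A.ell2) (T : Adjointable (B.fiber 1) B.ell2) :
    α.opMap (S ⊗ₜ T) = α.opTensor S T := rfl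

theorem opTensor_mul (S S' : Adjointable (A.fiber 1) A.ell2)
    (T T' : Adjointable (B.fiber 1) B.ell2) :
    α.opTensor S T * α.opTensor S' T' = α.opTensor (S * S') (T * T') :=
  α.adjointable_ext fun ξ η => by simp only [Adjointable.mul_apply, opTensor_tmul]

theorem star_opTensor (S : Adjointable (A.fiber 1) A.ell2)
    (T : Adjointable (B.fiber 1) B.ell2) :
    star (α.opTensor S T) = α.opTensor (star S) (star T) :=
  Subtype.ext (Adjointable.star_mk _ _ _)

/-- The norm `α̂` on `𝓛(ℓ²(A)) ⊙ 𝓛(ℓ²(B))`, the operator norm on `ℓ²(A) ⊗_α ℓ²(B)`. -/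
noncomputable def hatNorm
    (z : Adjointable (A.fiber 1) A.ell2 ⊗[ℂ] Adjointable (B.fiber 1) B.ell2) : ℝ := ‖α.opMap z‖

/-- The image of `P ⊙ Q` in `𝓛(ℓ²(A) ⊗_α ℓ²(B))`, for *-subalgebras `P` and `Q`. -/
noncomputable def opRange (P : NonUnitalStarSubalgebra ℂ (Adjointable (A.fiber 1) A.ell2))
    (Q : NonUnitalStarSubalgebra ℂ (Adjointable (B.fiber 1) B.ell2)) :
    NonUnitalStarSubalgebra ℂ (Adjointable (α.tensor.fiber 1) (Ell2Tensor α)) where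
  __ := Submodule.span ℂ {R | ∃ S ∈ P, ∃ T ∈ Q, R = α.opTensor S T}
  mul_mem' {R R'} h h' := by
    refine Submodule.span_induction₂ (p := fun R R' _ _ => R * R' ∈ Submodule.span ℂ _)
      ?_ ?_ ?_ ?_ ?_ ?_ ?_ h h'
    · rintro _ _ ⟨S, hS, T, hT, rfl⟩ ⟨S', hS', T', hT', rfl⟩
      exact Submodule.subset_span ⟨_, mul_mem hS hS', _, mul_mem hT hT', α.opTensor_mul _ _ _ _⟩
    · intro x _; rw [zero_mul]; exact Submodule.zero_mem _
    · intro x _; rw [mul_zero]; exact Submodule.zero_mem _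
    · intro x y z _ _ _ h h'; rw [add_mul]; exact Submodule.add_mem _ h h'
    · intro x y z _ _ _ h h'; rw [mul_add]; exact Submodule.add_mem _ h h'
    · intro c x y _ _ h; rw [smul_mul_assoc]; exact Submodule.smul_mem _ _ h
    · intro c x y _ _ h; rw [mul_smul_comm]; exact Submodule.smul_mem _ _ h
  star_mem' {R} h := by
    refine Submodule.span_induction (p := fun R _ => star R ∈ Submodule.span ℂ _) ?_ ?_ ?_ ?_ h
    · rintro _ ⟨S, hS, T, hT, rfl⟩
      exact Submodule.subset_span ⟨_, star_mem hS, _, star_mem hT, α.star_opTensor _ _⟩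
    · rw [star_zero]; exact Submodule.zero_mem _
    · intro x y _ _ h h'; rw [star_add]; exact Submodule.add_mem _ h h'
    · intro c x _ h; rw [star_smul]; exact Submodule.smul_mem _ _ h

/-- The C⋆-algebra `𝓛(ℓ²(A)) ⊗_α̂ 𝓛(ℓ²(B))`: the closure of the algebraic tensor product in
`𝓛(ℓ²(A) ⊗_α ℓ²(B))`. -/
noncomputable def adjointableTensor :
    NonUnitalStarSubalgebra ℂ (Adjointable (α.tensor.fiber 1) (Ell2Tensor α)) :=
  (α.opRange ⊤ ⊤).topologicalClosure

instance : ContinuousStar α.adjointableTensor :=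
  ⟨(continuous_star.comp continuous_subtype_val).subtype_mk _⟩

/-- `C⋆ᵣ(A) ⊗_α̂ C⋆ᵣ(B)`: the closure of `C⋆ᵣ(A) ⊙ C⋆ᵣ(B)` in `𝓛(ℓ²(A)) ⊗_α̂ 𝓛(ℓ²(B))`. -/
noncomputable def reducedTensor : NonUnitalStarSubalgebra ℂ α.adjointableTensor :=
  ((α.opRange A.reducedCStar B.reducedCStar).comap
    (NonUnitalStarSubalgebraClass.subtype α.adjointableTensor)).topologicalClosure

end CStarNorm

end OpTensor

/-! Both reduced C⋆-algebras act on one and the same Hilbert module, up to a unitary. The map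
sending `ξ ⊙ η` to the section `(t, s) ↦ ξ(t) ⊗ η(s)` preserves inner products, because the sum of
`ξ(t)⋆ξ'(t) ⊗ η(s)⋆η'(s)` over `G × H` factors as `⟪ξ, ξ'⟫ ⊗ ⟪η, η'⟫` (`inner_sectionMap`). It
therefore extends to an isometry of the completion. The range of this isometry is closed and
contains the sections supported at one point with value in `A_t ⊙ B_s`. These values are dense in
the fiber, and finite sums of point sections are dense in `ℓ²`, so the isometry is onto
(`sectionCLM_surjective`). This is `U`, and `Ψ` is conjugation by `U`.

Conjugation is an isometric *-isomorphism of the full algebras of adjointable operators, and it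
carries `Λ(a) ⊗ Λ(b)` to `Λ(a ⊗ b)` (`opEquiv_lambda`). What remains is that it matches the two
subalgebras. Since `Λ(a)Λ(b) = Λ(ab)` and `Λ(a)⋆ = Λ(a⋆)`, the reduced algebra is just the closed
linear span of the `Λ(a)` (`toSubmodule_adjoin_lambda`), so only linear and continuity arguments are
needed. One inclusion follows from `‖S ⊗ T‖ ≤ ‖S‖‖T‖`, which allows passing from generators to
limits in each variable (`opEquiv_opTensor_mem`). The other holds because the image is closed and
contains every `Λ(a ⊗ b)`, hence every `Λ(x)` with `x` in a completed fiber
(`reducedTensorHom_surjective`).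

Definiteness of `α̂` is an algebraic matter. For `z = ∑ S_i ⊙ T_i`, the value at `(t, s)` of the
section obtained by applying `z` to `ξ ⊗ η` is `∑ (S_i ξ)(t) ⊗ (T_i η)(s)`, an element of the
uncompleted fiber, where `α` is a genuine norm. If the operator is zero, all these algebraic tensors
vanish. The evaluations `S ↦ (S ξ)(t)` separate operators, and tensor products of separating
families of linear maps over a field are again separating
(`TensorProduct.eq_zero_of_forall_map_eq_zero`), so `z = 0`. -/

/-! ### Separating families on algebraic tensor products. -/

section TensorInjective

variable {K V W : Type*} [Field K] [AddCommGroup V] [Module K V] [AddCommGroup W] [Module K W]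

/-- Separation is checked one factor at a time by slicing. A functional on `V' i` turns `z` into a
vector of `W`, which the `q j` detect; once all such slices vanish, the coefficients of `z` along a
basis of `W` are detected by the `p i`. No single map is assumed injective, so exactness of the
tensor product does not apply directly. -/
theorem TensorProduct.eq_zero_of_forall_map_eq_zero {ι κ : Type*} {V' : ι → Type*} {W' : κ → Type*}
    [∀ i, AddCommGroup (V' i)] [∀ i, Module K (V' i)] [∀ j, AddCommGroup (W' j)]
    [∀ j, Module K (W' j)] (p : ∀ i, V →ₗ[K] V' i) (q : ∀ j, W →ₗ[K] W' j)
    (hp : ∀ v, (∀ i, p i v = 0) → v = 0) (hq : ∀ w, (∀ j, q j w = 0) → w = 0) (z : V ⊗[K] W)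
    (hz : ∀ i j, TensorProduct.map (p i) (q j) z = 0) : z = 0 := by
  -- The slice of `z` along `f ∘ p i` is zero: applying `q j` to it is the same as slicing `(p i ⊗ q
  -- j) z = 0` along `f`.
  have h1 : ∀ i (f : Module.Dual K (V' i)), (f.comp (p i)).rTensor W z = 0 := fun i f => by
    refine (TensorProduct.lid K W).injective ?_
    rw [map_zero]
    refine hq _ fun j => ?_
    have e : (q j) ∘ₗ (TensorProduct.lid K W).toLinearMap ∘ₗ (f.comp (p i)).rTensor W
        = (TensorProduct.lid K (W' j)).toLinearMap ∘ₗ f.rTensor (W' j) ∘ₗ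
          TensorProduct.map (p i) (q j) := TensorProduct.ext' fun v w => by simp
    have := LinearMap.congr_fun e z
    simp only [LinearMap.comp_apply, hz, map_zero] at this
    exact this
  classical
  -- Write `z` as a finite sum of `v_k ⊗ b_k`. The `k`-th coordinate of the slice along `f ∘ p i` is
  -- `f (p i v_k)`, so `h1` and the abundance of functionals on `V' i` give `p i v_k = 0` for all
  -- `i`.
  let b := Module.Basis.ofVectorSpace K W
  refine (TensorProduct.equivFinsuppOfBasisRight b).injective ?_
  rw [map_zero]
  ext k
  refine hp _ fun i => (Module.forall_dual_apply_eq_zero_iff K _).1 fun f => ?_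
  have e : (f.comp (p i)) ∘ₗ Finsupp.lapply k ∘ₗ
        (TensorProduct.equivFinsuppOfBasisRight (M := V) b).toLinearMap
      = (b.coord k) ∘ₗ (TensorProduct.lid K W).toLinearMap ∘ₗ (f.comp (p i)).rTensor W :=
    TensorProduct.ext' fun v w => by
      simp [mul_comm]
  have := LinearMap.congr_fun e z
  simpa [h1] using this

end TensorInjective

/-! ### Density of finitely supported families in a Hilbert sum. -/

section HilbertSumSingle

namespace HilbertSum

open HilbertModule

variable {B : Type*} {ι : Type*} {E : ι → Type*} [NonUnitalCStarAlgebra B] [PartialOrder B]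
  [StarOrderedRing B] [∀ i, NormedAddCommGroup (E i)] [∀ i, NormedSpace ℂ (E i)]
  [∀ i, CompleteSpace (E i)] [∀ i, HilbertModule B (E i)] [DecidableEq ι]

theorem hasSum_inner_single {i : ι} (x : E i) :
    HasSum (fun j => inner B (Pi.single i x j) (Pi.single i x j)) (inner B x x) := by
  have h := hasSum_single (f := fun j => inner B ((Pi.single i x : ∀ j, E j) j)
    ((Pi.single i x : ∀ j, E j) j)) i fun j hj => by simp [Pi.single_eq_of_ne hj]
  simpa using h

variable (B) in
/-- The family supported at one index. -/
noncomputable def single (i : ι) : E i →ₗᵢ[ℂ] HilbertSum B E where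
  toFun x := mk (Pi.single i x) (hasSum_inner_single x).summable
  map_add' x y := by ext j; simp only [mk_apply, Pi.single_add, Pi.add_apply, add_apply]
  map_smul' z x := by ext j; simp only [mk_apply, Pi.single_smul, Pi.smul_apply, smul_apply,
    RingHom.id_apply]
  norm_map' x := by
    refine (pow_left_inj₀ (norm_nonneg _) (norm_nonneg _) two_ne_zero).1 ?_
    rw [HilbertModule.norm_sq B x, HilbertModule.norm_sq B]
    exact congrArg _ ((hasSum_inner _ _).unique (hasSum_inner_single x))

theorem single_apply (i : ι) (x : E i) (j : ι) : single B i x j = Pi.single i x j := rfl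

theorem sum_single_apply (s : Finset ι) (x : HilbertSum B E) (j : ι) :
    (∑ i ∈ s, single B i (x i) : HilbertSum B E) j = if j ∈ s then x j else 0 := by
  induction s using Finset.induction_on with
  | empty => simp
  | insert i s hi ih =>
    rw [Finset.sum_insert hi, add_apply, ih, single_apply]
    by_cases h : j = i
    · subst h; simp [hi]
    · simp [h]

/-- The squared norm of the remainder is the norm of a tail of the convergent series of `⟪x i, x
i⟫`, so the Cauchy criterion for that series controls it. -/
theorem tendsto_sum_single (x : HilbertSum B E) :
    Filter.Tendsto (fun s : Finset ι => ∑ i ∈ s, single B i (x i)) Filter.atTop (nhds x) := by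
  rw [Metric.tendsto_atTop]
  intro ε hε
  -- The square appears because the series measures `‖·‖²`; the half restores a strict inequality,
  -- since the limit over finite sets only yields `≤`.
  obtain ⟨s, hs⟩ := summable_iff_vanishing_norm.1 x.summable_self ((ε / 2) ^ 2) (by positivity)
  refine ⟨s, fun t ht => ?_⟩
  rw [dist_comm, dist_eq_norm]
  refine lt_of_le_of_lt ?_ (half_lt_self hε)
  refine (pow_le_pow_iff_left₀ (norm_nonneg _) (by positivity) two_ne_zero).1 ?_
  set y : HilbertSum B E := x - ∑ i ∈ t, single B i (x i) with hy
  have hyj : ∀ j, y j = if j ∈ t then 0 else x j := fun j => by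
    rw [hy, sub_apply, sum_single_apply]; split_ifs <;> simp
  have hl := (hasSum_inner y y).norm
  rw [HilbertModule.norm_sq B]
  refine le_of_tendsto hl (Filter.Eventually.of_forall fun r => ?_)
  -- The remainder vanishes on `t`, so a partial sum over `r` sees only `r \ t`, which is disjoint
  -- from `s` because `s ⊆ t`.
  have e : ∑ j ∈ r, inner B (y j) (y j) = ∑ j ∈ r \ t, inner B (x j) (x j) := by
    rw [Finset.sdiff_eq_filter, Finset.sum_filter]
    refine Finset.sum_congr rfl fun j _ => ?_
    rw [hyj]; split_ifs <;> simp
  rw [e]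
  exact (hs _ (Finset.disjoint_left.2 fun j hj hj' =>
    (Finset.mem_sdiff.1 hj).2 (ht hj'))).le

/-- A closed subspace containing all families supported at one index is everything. -/
theorem mem_of_forall_single_mem {F : Submodule ℂ (HilbertSum B E)}
    (hF : IsClosed (F : Set (HilbertSum B E))) (h : ∀ i (x : E i), single B i x ∈ F)
    (x : HilbertSum B E) : x ∈ F :=
  hF.mem_of_tendsto (tendsto_sum_single x)
    (Filter.Eventually.of_forall fun _ => F.sum_mem fun i _ => h i _)

end HilbertSum

end HilbertSumSingle

/-! ### Conjugation of adjointable operators by a unitary. -/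

section AdjointableConj

namespace ContinuousLinearMap

variable {E F : Type*} [NormedAddCommGroup E] [NormedSpace ℂ E] [NormedAddCommGroup F]
  [NormedSpace ℂ F]

/-- Conjugation of operators by an isometric linear bijection. -/
noncomputable def conjIsometry (U : E ≃ₗᵢ[ℂ] F) (T : E →L[ℂ] E) : F →L[ℂ] F :=
  U.toLinearIsometry.toContinuousLinearMap.comp
    (T.comp U.symm.toLinearIsometry.toContinuousLinearMap)

@[simp] theorem conjIsometry_apply (U : E ≃ₗᵢ[ℂ] F) (T : E →L[ℂ] E) (x : F) :
    conjIsometry U T x = U (T (U.symm x)) := rfl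

end ContinuousLinearMap

namespace Adjointable

open HilbertModule

variable {B E F : Type*} [NonUnitalCStarAlgebra B] [PartialOrder B] [StarOrderedRing B]
  [NormedAddCommGroup E] [NormedSpace ℂ E] [CompleteSpace E] [HilbertModule B E]
  [NormedAddCommGroup F] [NormedSpace ℂ F] [CompleteSpace F] [HilbertModule B F]

/-- Conjugation of adjointable operators by a unitary. -/
noncomputable def conj (U : E ≃ₗᵢ[ℂ] F) (hU : ∀ x y, inner B (U x) (U y) = inner B x y) :
    Adjointable B E ≃⋆ₐ[ℂ] Adjointable B F where
  toFun T := mk (ContinuousLinearMap.conjIsometry U T.1) (ContinuousLinearMap.conjIsometry U (star T).1) fun x y => by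
    -- After writing `y` as `U (U.symm y)`, unitarity strips `U` from both entries, the adjoint
    -- relation is used inside `E`, and unitarity puts `U` back.
    rw [ContinuousLinearMap.conjIsometry_apply,
      ContinuousLinearMap.conjIsometry_apply, ← U.apply_symm_apply y, hU, U.symm_apply_apply,
      inner_star_right, ← hU, U.apply_symm_apply]
  invFun T := mk (ContinuousLinearMap.conjIsometry U.symm T.1) (ContinuousLinearMap.conjIsometry U.symm (star T).1) fun x y => by
    rw [ContinuousLinearMap.conjIsometry_apply,
      ContinuousLinearMap.conjIsometry_apply, LinearIsometryEquiv.symm_symm, ← hU, U.apply_symm_apply,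
      inner_star_right, ← hU x, U.apply_symm_apply]
  left_inv T := Adjointable.ext fun x => by
    change U.symm (U (T.1 (U.symm (U x)))) = T.1 x
    simp
  right_inv T := Adjointable.ext fun x => by
    change U (U.symm (T.1 (U (U.symm x)))) = T.1 x
    simp
  map_mul' S T := Adjointable.ext fun x => by
    change U (S.1 (T.1 (U.symm x))) = U (S.1 (U.symm (U (T.1 (U.symm x)))))
    simp
  map_add' S T := Adjointable.ext fun x => map_add U _ _
  map_smul' z T := Adjointable.ext fun x => map_smul U _ _
  -- The star is defined through a choice of adjoint; `star_mk` identifies the chosen one with the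
  -- adjoint supplied to `mk`.
  map_star' T := Subtype.ext (star_mk _ _ _).symm

variable {U : E ≃ₗᵢ[ℂ] F} {hU : ∀ x y, inner B (U x) (U y) = inner B x y}

theorem conj_apply (T : Adjointable B E) (x : F) : (conj U hU T).1 x = U (T.1 (U.symm x)) := rfl

theorem conj_map (T : Adjointable B E) (x : E) : (conj U hU T).1 (U x) = U (T.1 x) := by
  rw [conj_apply, U.symm_apply_apply]

theorem norm_conj (T : Adjointable B E) : ‖conj U hU T‖ = ‖T‖ := by
  refine le_antisymm (ContinuousLinearMap.opNorm_le_bound _ (norm_nonneg T) fun x => ?_)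
    (ContinuousLinearMap.opNorm_le_bound _ (norm_nonneg (conj U hU T)) fun x => ?_)
  · change ‖(conj U hU T).1 x‖ ≤ _
    rw [conj_apply, U.norm_map, ← U.symm.norm_map x]
    exact T.le_norm _
  · change ‖T.1 x‖ ≤ _
    rw [← U.norm_map (T.1 x), ← conj_map (hU := hU), ← U.norm_map x]
    exact (conj U hU T).le_norm _

theorem isometry_conj : Isometry (conj U hU) :=
  AddMonoidHomClass.isometry_of_norm _ norm_conj

end Adjointable

end AdjointableConj

/-! ### The unitary from `ℓ²(A) ⊗_α ℓ²(B)` onto `ℓ²(A ⊗_α B)`. -/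

section TensorUnitary

variable {G : Type u} [Group G] {H : Type u'} [Group H] {A : FellBundle.{u, v} G}
  {B : FellBundle.{u', v'} H}

namespace CStarNorm

variable (α : CStarNorm (A.toStarBundle.algTensor B.toStarBundle))

/-- The isometry `ξ ⊙ η ↦ ((t, s) ↦ ξ(t) ⊗ η(s))`. -/
noncomputable def sectionIsometry : Ell2AlgTensor α →ₗᵢ[ℂ] α.tensor.ell2 where
  __ := α.sectionMap ∘ₗ α.toEll2Alg.symm.toLinearMap
  norm_map' x := by
    refine (pow_left_inj₀ (norm_nonneg _) (norm_nonneg _) two_ne_zero).1 ?_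
    rw [HilbertModule.norm_sq (α.tensor.fiber 1), norm_sq_alg]
    exact congrArg _ (α.inner_sectionMap _ _)

theorem sectionIsometry_toEll2Alg (x : A.ell2 ⊗[ℂ] B.ell2) :
    α.sectionIsometry (α.toEll2Alg x) = α.sectionMap x := rfl

/-- The continuous extension of `ξ ⊙ η ↦ ((t, s) ↦ ξ(t) ⊗ η(s))`. -/
noncomputable def sectionCLM : Ell2Tensor α →L[ℂ] α.tensor.ell2 :=
  α.sectionIsometry.toContinuousLinearMap.extend (Ell2Tensor.of α).toContinuousLinearMap

theorem sectionCLM_of (x : Ell2AlgTensor α) :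
    α.sectionCLM (Ell2Tensor.of α x) = α.sectionIsometry x :=
  ContinuousLinearMap.extend_eq _ (e := (Ell2Tensor.of α).toContinuousLinearMap)
    (Ell2Tensor.denseRange_of α) (Ell2Tensor.of α).isometry.isUniformInducing x

theorem norm_sectionCLM (x : Ell2Tensor α) : ‖α.sectionCLM x‖ = ‖x‖ := by
  refine (Ell2Tensor.denseRange_of α).induction_on (p := fun x => ‖α.sectionCLM x‖ = ‖x‖) x
    (isClosed_eq (by fun_prop) (by fun_prop)) fun x => ?_
  rw [sectionCLM_of, LinearIsometry.norm_map, LinearIsometry.norm_map]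

theorem sectionCLM_tmul (ξ : A.ell2) (η : B.ell2) :
    α.sectionCLM (Ell2Tensor.tmul α ξ η) = α.sectionTmul ξ η :=
  (α.sectionCLM_of _).trans rfl

theorem inner_sectionCLM (x y : Ell2Tensor α) :
    HilbertModule.inner (α.tensor.fiber 1) (α.sectionCLM x) (α.sectionCLM y)
      = HilbertModule.inner (α.tensor.fiber 1) x y := by
  -- In the bundled continuous form both sides are visibly continuous, so it is enough to compare
  -- them on the dense algebraic tensor product.
  simp only [← HilbertModule.innerSL_apply]
  refine (Ell2Tensor.denseRange_of α).induction_on₂ (p := fun x y =>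
    HilbertModule.innerSL (α.tensor.fiber 1) (α.sectionCLM x) (α.sectionCLM y)
      = HilbertModule.innerSL (α.tensor.fiber 1) x y)
    (isClosed_eq (by fun_prop) (by fun_prop)) (fun x y => ?_) x y
  obtain ⟨x, rfl⟩ := α.toEll2Alg.surjective x
  obtain ⟨y, rfl⟩ := α.toEll2Alg.surjective y
  rw [sectionCLM_of, sectionCLM_of, HilbertModule.innerSL_apply, HilbertModule.innerSL_apply,
    Ell2Tensor.inner_of, sectionIsometry_toEll2Alg, sectionIsometry_toEll2Alg, inner_sectionMap]

/-- Away from `p` at least one tensor factor is zero. This places the basic point sections in the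
range of `sectionCLM`. -/
theorem sectionTmul_single [DecidableEq G] [DecidableEq H] (p : G × H) (a : A.fiber p.1)
    (b : B.fiber p.2) :
    α.sectionTmul (HilbertSum.single (A.fiber 1) p.1 a) (HilbertSum.single (B.fiber 1) p.2 b)
      = HilbertSum.single (α.tensor.fiber 1) p (α.incl p (a ⊗ₜ[ℂ] b)) := by
  ext q
  change α.incl q ((Pi.single p.1 a : ∀ t, A.fiber t) q.1 ⊗ₜ[ℂ]
    (Pi.single p.2 b : ∀ s, B.fiber s) q.2)
    = (Pi.single p (α.incl p (a ⊗ₜ[ℂ] b)) : ∀ q, α.tensor.fiber q) q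
  by_cases h : q = p
  · subst h; simp only [Pi.single_eq_same]
  · rw [Pi.single_eq_of_ne h]
    rw [Prod.ext_iff, not_and_or] at h
    rcases h with h | h
    · rw [Pi.single_eq_of_ne h, TensorProduct.zero_tmul, map_zero]
    · rw [Pi.single_eq_of_ne h, TensorProduct.tmul_zero, map_zero]

theorem denseRange_incl (p : G × H) : DenseRange (α.incl p) :=
  α.preTensor.denseRange_toCompletion p

/-- An isometry from a complete space has closed range, so it suffices to reach a set with dense
span. Point sections form such a set, and their values may be taken in the algebraic fiber, then to
be elementary tensors. -/
theorem sectionCLM_surjective : Function.Surjective α.sectionCLM := by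
  classical
  have hcl : IsClosed (LinearMap.range α.sectionCLM.toLinearMap : Set α.tensor.ell2) :=
    (AddMonoidHomClass.isometry_of_norm α.sectionCLM
      α.norm_sectionCLM).isClosedEmbedding.isClosed_range
  refine HilbertSum.mem_of_forall_single_mem hcl fun p x => ?_
  -- The closed range is pulled back along the isometric embedding of the fiber over `p`; this
  -- reduces a value in the completed fiber to one in `A_t ⊙ B_s`.
  refine (α.denseRange_incl p).induction_on (p := fun x => HilbertSum.single (α.tensor.fiber 1) p x
    ∈ LinearMap.range α.sectionCLM.toLinearMap) x
    (hcl.preimage (HilbertSum.single (α.tensor.fiber 1) p).continuous) fun y => ?_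
  induction y using TensorProduct.induction_on with
  | zero => rw [map_zero, map_zero]; exact Submodule.zero_mem _
  | add y y' h h' => rw [map_add, map_add]; exact Submodule.add_mem _ h h'
  | tmul a b =>
    rw [← sectionTmul_single, ← sectionCLM_tmul]
    exact LinearMap.mem_range_self _ _

/-- The unitary `ℓ²(A) ⊗_α ℓ²(B) → ℓ²(A ⊗_α B)`. -/
noncomputable def sectionUnitary : Ell2Tensor α ≃ₗᵢ[ℂ] α.tensor.ell2 :=
  LinearIsometryEquiv.ofSurjective
    { α.sectionCLM.toLinearMap with norm_map' := α.norm_sectionCLM } α.sectionCLM_surjective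

theorem sectionUnitary_tmul (ξ : A.ell2) (η : B.ell2) :
    α.sectionUnitary (Ell2Tensor.tmul α ξ η) = α.sectionTmul ξ η := α.sectionCLM_tmul ξ η

theorem inner_sectionUnitary (x y : Ell2Tensor α) :
    HilbertModule.inner (α.tensor.fiber 1) (α.sectionUnitary x) (α.sectionUnitary y)
      = HilbertModule.inner (α.tensor.fiber 1) x y := α.inner_sectionCLM x y

/-- Module linearity is automatic for a surjective map preserving inner products: against any test
vector `U z`, both sides give `⟪z, x⟫ c`. -/
theorem sectionUnitary_act (x : Ell2Tensor α) (c : α.tensor.fiber 1) :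
    α.sectionUnitary (HilbertModule.act x c) = HilbertModule.act (α.sectionUnitary x) c := by
  refine HilbertModule.ext_inner (α.tensor.fiber 1) fun z => ?_
  obtain ⟨z, rfl⟩ := α.sectionUnitary.surjective z
  rw [inner_sectionUnitary, HilbertModule.inner_act, HilbertModule.inner_act, inner_sectionUnitary]

end CStarNorm

/-! ### Definiteness of `α̂`. -/

/-- Evaluation of an operator at `ξ` and at a point. -/
noncomputable def FellBundle.evalOp (A : FellBundle.{u, v} G) (i : A.ell2 × G) :
    Adjointable (A.fiber 1) A.ell2 →ₗ[ℂ] A.fiber i.2 where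
  toFun S := S.1 i.1 i.2
  map_add' _ _ := rfl
  map_smul' _ _ := rfl

theorem FellBundle.eq_zero_of_evalOp (A : FellBundle.{u, v} G)
    (S : Adjointable (A.fiber 1) A.ell2) (h : ∀ i, A.evalOp i S = 0) : S = 0 :=
  Adjointable.ext fun ξ => HilbertSum.ext fun t => h (ξ, t)

namespace CStarNorm

variable (α : CStarNorm (A.toStarBundle.algTensor B.toStarBundle))

/-- Since `z` is a finite sum, its values on elementary tensors stay in the image of the uncompleted
fiber. This converts an equation between operators on a completion into one in `A_t ⊙ B_s`. -/
theorem sectionUnitary_opMap_tmul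
    (z : Adjointable (A.fiber 1) A.ell2 ⊗[ℂ] Adjointable (B.fiber 1) B.ell2)
    (ξ : A.ell2) (η : B.ell2) (t : G) (s : H) :
    α.sectionUnitary ((α.opMap z).1 (Ell2Tensor.tmul α ξ η)) (t, s)
      = α.incl (t, s) (TensorProduct.map (A.evalOp (ξ, t)) (B.evalOp (η, s)) z) := by
  induction z using TensorProduct.induction_on with
  | zero =>
    rw [map_zero, map_zero, map_zero]
    change α.sectionUnitary 0 (t, s) = 0
    rw [map_zero]; rfl
  | add z z' h h' =>
    rw [map_add, map_add, map_add, ← h, ← h', Adjointable.add_apply, map_add]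
    rfl
  | tmul S T => rw [opMap_tmul, opTensor_tmul, sectionUnitary_tmul]; rfl

/-- Vanishing of the operator forces all its pointwise values to vanish in the completed fibers,
hence in the algebraic ones; the evaluations then separate the tensor `z` itself. -/
theorem eq_zero_of_hatNorm_eq_zero
    (z : Adjointable (A.fiber 1) A.ell2 ⊗[ℂ] Adjointable (B.fiber 1) B.ell2)
    (hz : α.hatNorm z = 0) : z = 0 := by
  refine TensorProduct.eq_zero_of_forall_map_eq_zero A.evalOp B.evalOp A.eq_zero_of_evalOp
    B.eq_zero_of_evalOp z fun i j => ?_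
  have h0 : α.opMap z = 0 := norm_eq_zero.1 hz
  have h := α.sectionUnitary_opMap_tmul z i.1 j.1 i.2 j.2
  -- Here definiteness of `α` on the algebraic fiber enters: `α.incl` preserves norms, so an element
  -- that becomes zero in the completion was already zero.
  refine α.eq_zero (t := (i.2, j.2)) _ ?_
  rw [← α.norm_incl (p := (i.2, j.2)), norm_eq_zero]
  refine h.symm.trans ?_
  rw [h0]
  change α.sectionUnitary 0 (i.2, j.2) = 0
  rw [map_zero]; rfl

end CStarNorm

end TensorUnitary

/-! ### The reduced algebra as the closed linear span of the operators `Λ(a)`. -/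

namespace FellBundle

variable {G : Type u} [Group G] (A : FellBundle.{u, v} G)

theorem lambda_apply {t : G} (a : A.fiber t) (ξ : A.ell2) (s : G) :
    (A.lambda a).1 ξ s = A.mul (mul_inv_cancel_left t s) a (ξ (t⁻¹ * s)) := rfl

theorem lambda_mul_lambda {t s : G} (a : A.fiber t) (b : A.fiber s) :
    A.lambda a * A.lambda b = A.lambda (A.mul rfl a b) := by
  refine Adjointable.ext fun ξ => HilbertSum.ext fun r => ?_
  rw [Adjointable.mul_apply, lambda_apply, lambda_apply, lambda_apply,
    ← A.mul_assoc (rs := t * s) rfl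
      (show t * s * (s⁻¹ * (t⁻¹ * r)) = r by simp only [mul_assoc, mul_inv_cancel_left])]
  -- The two sides evaluate `ξ` at `s⁻¹ (t⁻¹ r)` and at `(t s)⁻¹ r`, equal indices whose fibers are
  -- not definitionally the same type.
  exact A.mul_section_congr _ ξ.1 (by rw [mul_inv_rev, mul_assoc]) _ _

theorem star_lambda {t : G} (a : A.fiber t) : star (A.lambda a) = A.lambda (A.star rfl a) :=
  Subtype.ext (Adjointable.star_mk _ _ _)

theorem norm_lambda_le {t : G} (a : A.fiber t) : ‖A.lambda a‖ ≤ ‖a‖ := by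
  change ‖A.lambdaCLM a‖ ≤ ‖a‖
  unfold lambdaCLM
  exact LinearMap.mkContinuous_norm_le _ (norm_nonneg a) _

/-- The map `Λ` on a fiber, as a continuous linear map. -/
noncomputable def lambdaL (t : G) : A.fiber t →L[ℂ] Adjointable (A.fiber 1) A.ell2 :=
  LinearMap.mkContinuous
    { toFun := A.lambda
      map_add' := fun a b => Adjointable.ext fun ξ => HilbertSum.ext fun s => by
        rw [Adjointable.add_apply, HilbertSum.add_apply, lambda_apply, lambda_apply, lambda_apply,
          map_add, LinearMap.add_apply]
      map_smul' := fun z a => Adjointable.ext fun ξ => HilbertSum.ext fun s => by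
        rw [RingHom.id_apply, Adjointable.smul_apply, HilbertSum.smul_apply, lambda_apply,
          lambda_apply, map_smul, LinearMap.smul_apply] } 1
    fun a => by rw [one_mul]; exact A.norm_lambda_le a

/-- The operators `Λ(a)` span a *-subalgebra. -/
theorem toSubmodule_adjoin_lambda :
    (NonUnitalStarAlgebra.adjoin ℂ {T | ∃ (t : G) (a : A.fiber t), T = A.lambda a}).toSubmodule
      = Submodule.span ℂ {T | ∃ (t : G) (a : A.fiber t), T = A.lambda a} := by
  set s : Set (Adjointable (A.fiber 1) A.ell2) := {T | ∃ (t : G) (a : A.fiber t), T = A.lambda a}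
    with hs
  -- The adjoined algebra is the span of the semigroup generated by `s ∪ star s`. This semigroup is
  -- `s` itself, since adjoints and products of operators `Λ(a)` are again of this form, over the
  -- inverse and the product index.
  have hstar : star s ⊆ s := by
    rintro T ⟨t, a, h⟩
    exact ⟨t⁻¹, A.star rfl a, by rw [← star_star T, h, star_lambda]⟩
  have hmul : (Subsemigroup.closure s : Set (Adjointable (A.fiber 1) A.ell2)) = s :=
    Subsemigroup.closure_eq
      { carrier := s
        mul_mem' := by
          rintro _ _ ⟨t, a, rfl⟩ ⟨r, b, rfl⟩
          exact ⟨t * r, _, A.lambda_mul_lambda a b⟩ } ▸ rfl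
  rw [NonUnitalStarAlgebra.adjoin_eq_span, Set.union_eq_left.2 hstar, hmul]

theorem lambda_mem_reducedCStar {t : G} (a : A.fiber t) : A.lambda a ∈ A.reducedCStar :=
  NonUnitalStarSubalgebra.le_topologicalClosure _
    (NonUnitalStarAlgebra.subset_adjoin ℂ _ ⟨t, a, rfl⟩)

/-- A closed subspace containing all `Λ(a)` contains `C⋆ᵣ(A)`. -/
theorem mem_of_mem_reducedCStar {F : Submodule ℂ (Adjointable (A.fiber 1) A.ell2)}
    (hF : IsClosed (F : Set (Adjointable (A.fiber 1) A.ell2)))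
    (h : ∀ (t : G) (a : A.fiber t), A.lambda a ∈ F) {T : Adjointable (A.fiber 1) A.ell2}
    (hT : T ∈ A.reducedCStar) : T ∈ F := by
  refine closure_minimal (fun S hS => ?_) hF hT
  -- Replacing the generated algebra by a span is what lets `F` be a mere subspace, with no closure
  -- under products.
  have hS' : S ∈ Submodule.span ℂ {T | ∃ (t : G) (a : A.fiber t), T = A.lambda a} := by
    rw [← toSubmodule_adjoin_lambda]; exact hS
  refine Submodule.span_le.2 ?_ hS'
  rintro _ ⟨t, a, rfl⟩
  exact h t a

end FellBundle

/-! ### The isomorphism of the reduced algebras. -/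

section ReducedTensor

variable {G : Type u} [Group G] {H : Type u'} [Group H] {A : FellBundle.{u, v} G}
  {B : FellBundle.{u', v'} H}

namespace CStarNorm

variable (α : CStarNorm (A.toStarBundle.algTensor B.toStarBundle))

/-- This bound makes `S ⊗ T` continuous in each variable, so that membership statements pass from
the `Λ(a)` to their closed span. It extends `norm_algOp_le` by density. -/
theorem norm_opTensor_le (S : Adjointable (A.fiber 1) A.ell2)
    (T : Adjointable (B.fiber 1) B.ell2) : ‖α.opTensor S T‖ ≤ ‖S‖ * ‖T‖ := by
  refine ContinuousLinearMap.opNorm_le_bound _ (by positivity) fun x => ?_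
  change ‖α.opCLM S T x‖ ≤ _
  refine (Ell2Tensor.denseRange_of α).induction_on
    (p := fun x => ‖α.opCLM S T x‖ ≤ ‖S‖ * ‖T‖ * ‖x‖) x
    (isClosed_le (by fun_prop) (by fun_prop)) fun x => ?_
  obtain ⟨x, rfl⟩ := α.toEll2Alg.surjective x
  rw [opCLM_of]
  exact α.norm_algOp_le S T x

/-- `S ⊗ T` as a continuous bilinear map. -/
noncomputable def opTensorL : Adjointable (A.fiber 1) A.ell2 →L[ℂ]
    Adjointable (B.fiber 1) B.ell2 →L[ℂ] Adjointable (α.tensor.fiber 1) (Ell2Tensor α) :=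
  ((TensorProduct.mk ℂ _ _).compr₂ α.opMap).mkContinuous₂ 1 fun S T => by
    rw [one_mul]; exact α.norm_opTensor_le S T

/-- The isomorphism `𝓛(ℓ²(A) ⊗_α ℓ²(B)) → 𝓛(ℓ²(A ⊗_α B))`. -/
noncomputable def opEquiv : Adjointable (α.tensor.fiber 1) (Ell2Tensor α) ≃⋆ₐ[ℂ]
    Adjointable (α.tensor.fiber 1) α.tensor.ell2 :=
  Adjointable.conj α.sectionUnitary α.inner_sectionUnitary

theorem opEquiv_map (T : Adjointable (α.tensor.fiber 1) (Ell2Tensor α)) (x : Ell2Tensor α) :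
    (α.opEquiv T).1 (α.sectionUnitary x) = α.sectionUnitary (T.1 x) := Adjointable.conj_map T x

theorem isometry_opEquiv : Isometry α.opEquiv := Adjointable.isometry_conj

/-- The isomorphism `𝓛(ℓ²(A) ⊗_α ℓ²(B)) → 𝓛(ℓ²(A ⊗_α B))` as a linear map. -/
noncomputable def opLinear : Adjointable (α.tensor.fiber 1) (Ell2Tensor α) →ₗ[ℂ]
    Adjointable (α.tensor.fiber 1) α.tensor.ell2 where
  toFun := α.opEquiv
  map_add' := map_add α.opEquiv
  map_smul' := map_smul α.opEquiv

/-- At a point `q` of `G × H` both operators shift by `(t, s)⁻¹` and multiply on the left, and `(a ⊗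
b)(x ⊗ y) = ax ⊗ by` in the tensor bundle. -/
theorem opEquiv_lambda {t : G} {s : H} (a : A.fiber t) (b : B.fiber s) :
    α.opEquiv (α.opTensor (A.lambda a) (B.lambda b)) = α.tensor.lambda (α.tmul a b) := by
  -- Moved to the side of `Ell2Tensor`, the identity only needs testing on elementary tensors;
  -- `opEquiv_map` then carries the test back to sections.
  rw [← StarAlgEquiv.eq_symm_apply]
  refine α.adjointable_ext fun ξ η => α.sectionUnitary.injective ?_
  rw [← opEquiv_map, ← opEquiv_map, StarAlgEquiv.apply_symm_apply, opEquiv_map, opTensor_tmul,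
    sectionUnitary_tmul, sectionUnitary_tmul]
  refine HilbertSum.ext fun q => ?_
  exact (α.tensor_mul_incl (mul_inv_cancel_left (t, s) q) (a ⊗ₜ[ℂ] b)
    (ξ (t⁻¹ * q.1) ⊗ₜ[ℂ] η (s⁻¹ * q.2))).symm

/-- Bilinearity and continuity allow one variable at a time: with the other fixed, the admissible
operators form a closed subspace, so the generators decide. -/
theorem opEquiv_opTensor_mem {S : Adjointable (A.fiber 1) A.ell2}
    {T : Adjointable (B.fiber 1) B.ell2} (hS : S ∈ A.reducedCStar) (hT : T ∈ B.reducedCStar) :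
    α.opEquiv (α.opTensor S T) ∈ α.tensor.reducedCStar := by
  have hcl : IsClosed (α.tensor.reducedCStar : Set (Adjointable (α.tensor.fiber 1) α.tensor.ell2)) :=
    NonUnitalStarSubalgebra.isClosed_topologicalClosure _
  let F := α.tensor.reducedCStar.toSubmodule.comap α.opLinear
  have hF : IsClosed (F : Set (Adjointable (α.tensor.fiber 1) (Ell2Tensor α))) :=
    hcl.preimage α.isometry_opEquiv.continuous
  -- First `S` is reduced to some `Λ(a)` with `T` held arbitrary, then `T` to some `Λ(b)`.
  refine A.mem_of_mem_reducedCStar (F := F.comap (α.opTensorL.flip T).toLinearMap)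
    (hF.preimage (α.opTensorL.flip T).continuous) (fun t a => ?_) hS
  refine B.mem_of_mem_reducedCStar (F := F.comap (α.opTensorL (A.lambda a)).toLinearMap)
    (hF.preimage (α.opTensorL (A.lambda a)).continuous) (fun s b => ?_) hT
  change α.opEquiv (α.opTensor (A.lambda a) (B.lambda b)) ∈ α.tensor.reducedCStar
  rw [opEquiv_lambda]
  exact α.tensor.lambda_mem_reducedCStar _

/-- The embedding `𝓛(ℓ²(A)) ⊗_α̂ 𝓛(ℓ²(B)) → 𝓛(ℓ²(A ⊗_α B))`. -/
noncomputable def adjointableTensorHom :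
    α.adjointableTensor →⋆ₙₐ[ℂ] Adjointable (α.tensor.fiber 1) α.tensor.ell2 :=
  (α.opEquiv : _ →⋆ₙₐ[ℂ] Adjointable (α.tensor.fiber 1) α.tensor.ell2).comp
    (NonUnitalStarSubalgebraClass.subtype α.adjointableTensor)

theorem isometry_adjointableTensorHom : Isometry α.adjointableTensorHom :=
  α.isometry_opEquiv.comp isometry_subtype_coe

/-- The preimage of the closed target is closed, so only the span of the `S ⊗ T` needs checking, and
by linearity only each `S ⊗ T`. -/
theorem adjointableTensorHom_mem (z : α.reducedTensor) :
    α.adjointableTensorHom z.1 ∈ α.tensor.reducedCStar := by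
  have hcl : IsClosed (α.tensor.reducedCStar : Set (Adjointable (α.tensor.fiber 1) α.tensor.ell2)) :=
    NonUnitalStarSubalgebra.isClosed_topologicalClosure _
  refine closure_minimal (t := α.adjointableTensorHom ⁻¹' α.tensor.reducedCStar) (fun w hw => ?_)
    (hcl.preimage α.isometry_adjointableTensorHom.continuous) z.2
  have hw' : w.1 ∈ Submodule.span ℂ
      {R | ∃ S ∈ A.reducedCStar, ∃ T ∈ B.reducedCStar, R = α.opTensor S T} := hw
  refine (Submodule.span_le (p := α.tensor.reducedCStar.toSubmodule.comap α.opLinear)).2 ?_ hw'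
  rintro _ ⟨S, hS, T, hT, rfl⟩
  exact α.opEquiv_opTensor_mem hS hT

theorem opTensor_mem_adjointableTensor (S : Adjointable (A.fiber 1) A.ell2)
    (T : Adjointable (B.fiber 1) B.ell2) : α.opTensor S T ∈ α.adjointableTensor :=
  NonUnitalStarSubalgebra.le_topologicalClosure _
    (Submodule.subset_span ⟨S, NonUnitalStarAlgebra.mem_top, T, NonUnitalStarAlgebra.mem_top, rfl⟩)

theorem opTensor_mem_reducedTensor {S : Adjointable (A.fiber 1) A.ell2}
    {T : Adjointable (B.fiber 1) B.ell2} (hS : S ∈ A.reducedCStar) (hT : T ∈ B.reducedCStar) :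
    (⟨α.opTensor S T, α.opTensor_mem_adjointableTensor S T⟩ : α.adjointableTensor)
      ∈ α.reducedTensor := by
  refine NonUnitalStarSubalgebra.le_topologicalClosure _ ?_
  exact Submodule.subset_span ⟨S, hS, T, hT, rfl⟩

/-- The element `Λ(a) ⊗ Λ(b)` of `C⋆ᵣ(A) ⊗_α̂ C⋆ᵣ(B)`. -/
noncomputable def lambdaTensor {t : G} {s : H} (a : A.fiber t) (b : B.fiber s) : α.reducedTensor :=
  ⟨_, α.opTensor_mem_reducedTensor (A.lambda_mem_reducedCStar a) (B.lambda_mem_reducedCStar b)⟩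

theorem coe_lambdaTensor {t : G} {s : H} (a : A.fiber t) (b : B.fiber s) :
    (α.lambdaTensor a b).1.1 = α.opTensor (A.lambda a) (B.lambda b) := rfl

/-- The embedding of `C⋆ᵣ(A) ⊗_α̂ C⋆ᵣ(B)` in `C⋆ᵣ(A ⊗_α B)`. -/
noncomputable def reducedTensorHom : α.reducedTensor →⋆ₙₐ[ℂ] α.tensor.reducedCStar :=
  NonUnitalStarAlgHom.codRestrict
    (α.adjointableTensorHom.comp (NonUnitalStarSubalgebraClass.subtype α.reducedTensor))
    α.tensor.reducedCStar α.adjointableTensorHom_mem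

theorem isometry_reducedTensorHom : Isometry α.reducedTensorHom := fun z w =>
  (α.isometry_adjointableTensorHom.comp isometry_subtype_coe) z w

/-- Completeness of `α.reducedTensor` is needed for its isometric image to be closed. It is a closed
subspace of `α.adjointableTensor`, which must therefore be complete first. -/
instance : CompleteSpace α.adjointableTensor :=
  (NonUnitalStarSubalgebra.isClosed_topologicalClosure _).completeSpace_coe

instance : CompleteSpace α.reducedTensor :=
  (NonUnitalStarSubalgebra.isClosed_topologicalClosure _).completeSpace_coe

/-- The image is a closed subspace, so it suffices that it contains `Λ(x)` for every `x` in a fiber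
of the tensor bundle. -/
theorem reducedTensorHom_surjective : Function.Surjective α.reducedTensorHom := by
  rintro ⟨T, hT⟩
  have hf : Isometry fun z : α.reducedTensor => α.opEquiv z.1.1 :=
    α.isometry_adjointableTensorHom.comp isometry_subtype_coe
  -- The image is taken in the full operator algebra, where `mem_of_mem_reducedCStar` applies.
  let F : Submodule ℂ (Adjointable (α.tensor.fiber 1) α.tensor.ell2) :=
    { carrier := Set.range fun z : α.reducedTensor => α.opEquiv z.1.1
      add_mem' := by
        rintro _ _ ⟨z, rfl⟩ ⟨w, rfl⟩
        exact ⟨z + w, map_add α.opEquiv z.1.1 w.1.1⟩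
      zero_mem' := ⟨0, map_zero α.opEquiv⟩
      smul_mem' := by
        rintro c _ ⟨z, rfl⟩
        exact ⟨c • z, map_smul α.opEquiv c z.1.1⟩ }
  have hcl : IsClosed (F : Set (Adjointable (α.tensor.fiber 1) α.tensor.ell2)) :=
    hf.isClosedEmbedding.isClosed_range
  have hmem : T ∈ F := by
    refine α.tensor.mem_of_mem_reducedCStar hcl (fun p x => ?_) hT
    -- `Λ` is norm continuous on each fiber, so the completed fiber may be replaced by `A_t ⊙ B_s`;
    -- elementary tensors are then covered by `opEquiv_lambda`.
    refine (α.denseRange_incl p).induction_on (p := fun x => α.tensor.lambdaL p x ∈ F) x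
      (hcl.preimage (α.tensor.lambdaL p).continuous) fun y => ?_
    induction y using TensorProduct.induction_on with
    | zero => rw [map_zero, map_zero]; exact Submodule.zero_mem _
    | add y y' h h' => rw [map_add, map_add]; exact Submodule.add_mem _ h h'
    | tmul a b => exact ⟨α.lambdaTensor a b, α.opEquiv_lambda a b⟩
  obtain ⟨z, hz⟩ := hmem
  exact ⟨z, Subtype.ext hz⟩

/-- The isomorphism `C⋆ᵣ(A) ⊗_α̂ C⋆ᵣ(B) → C⋆ᵣ(A ⊗_α B)`. -/
noncomputable def reducedTensorEquiv : α.reducedTensor ≃⋆ₐ[ℂ] α.tensor.reducedCStar :=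
  StarAlgEquiv.ofBijective α.reducedTensorHom
    ⟨α.isometry_reducedTensorHom.injective, α.reducedTensorHom_surjective⟩

theorem coe_reducedTensorEquiv (z : α.reducedTensor) :
    (α.reducedTensorEquiv z : Adjointable (α.tensor.fiber 1) α.tensor.ell2)
      = α.opEquiv z.1.1 := rfl

end CStarNorm

end ReducedTensor

/-! ### The main theorem. -/

theorem mainTheorem6 {G : Type u} [Group G] {H : Type u'} [Group H] (A : FellBundle.{u, v} G)
    (B : FellBundle.{u', v'} H) (α : CStarNorm (A.toStarBundle.algTensor B.toStarBundle)) :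
    (∀ z : Adjointable (A.fiber 1) A.ell2 ⊗[ℂ] Adjointable (B.fiber 1) B.ell2,
      α.hatNorm z = 0 → z = 0) ∧
    ∃ U : CStarNorm.Ell2Tensor α ≃ₗᵢ[ℂ] α.tensor.ell2,
      (∀ x y, HilbertModule.inner (α.tensor.fiber 1) (U x) (U y)
        = HilbertModule.inner (α.tensor.fiber 1) x y) ∧
      (∀ x (c : α.tensor.fiber 1), U (HilbertModule.act x c) = HilbertModule.act (U x) c) ∧
      (∀ (ξ : A.ell2) (η : B.ell2) (t : G) (s : H),
        U (CStarNorm.Ell2Tensor.tmul α ξ η) (t, s) = α.tmul (ξ t) (η s)) ∧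
      ∃ Ψ : α.reducedTensor ≃⋆ₐ[ℂ] α.tensor.reducedCStar,
        (∀ z, ‖(Ψ z : Adjointable (α.tensor.fiber 1) α.tensor.ell2)‖
          = ‖((z : α.adjointableTensor) :
              Adjointable (α.tensor.fiber 1) (CStarNorm.Ell2Tensor α))‖) ∧
        (∀ (t : G) (s : H) (a : A.fiber t) (b : B.fiber s), ∃ z : α.reducedTensor,
          ((z : α.adjointableTensor) : Adjointable (α.tensor.fiber 1) (CStarNorm.Ell2Tensor α))
            = α.opTensor (A.lambda a) (B.lambda b) ∧
          (Ψ z : Adjointable (α.tensor.fiber 1) α.tensor.ell2)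
            = α.tensor.lambda (α.tmul a b)) ∧
        (∀ (z : α.reducedTensor) (x : CStarNorm.Ell2Tensor α),
          (Ψ z : Adjointable (α.tensor.fiber 1) α.tensor.ell2).1 (U x)
            = U (((z : α.adjointableTensor) :
              Adjointable (α.tensor.fiber 1) (CStarNorm.Ell2Tensor α)).1 x)) := by

  refine ⟨α.eq_zero_of_hatNorm_eq_zero, α.sectionUnitary, α.inner_sectionUnitary,
    α.sectionUnitary_act, fun ξ η t s => ?_, α.reducedTensorEquiv, fun z => ?_,
    fun t s a b => ⟨α.lambdaTensor a b, α.coe_lambdaTensor a b, ?_⟩, fun z x => ?_⟩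
  · rw [α.sectionUnitary_tmul]; rfl
  -- The image of `z` is literally its conjugate by `U`, so the norm is preserved in the ambient
  -- operator algebras.
  · rw [α.coe_reducedTensorEquiv]; exact Adjointable.norm_conj _
  · rw [α.coe_reducedTensorEquiv, α.coe_lambdaTensor, α.opEquiv_lambda]
  · rw [α.coe_reducedTensorEquiv, α.opEquiv_map]
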